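/- Let $G=(V,E)$ be an undirected simple graph with countable edge set whose vertex degrees satisfy $d_x\le d<\infty$ for all $x\in V$, and let $\operatorname{d}(x,x')$ be the graph distance, with $\operatorname{d}(x,x')=\infty$ and $e^{-g\cdot\infty}=0$ if $x,x'$ lie in different connected components. Let $D$ be the set of directed edges obtained by giving each edge both orientations; $(xy)\in D$ denotes the edge from $y$ to $x$, and $|xy\rangle$ denotes the corresponding canonical basis vector of $\ell^2(D)$. A family of scattering matrices $\mathcal S=(S(x))_{x\in V}$ consists of unitary matrices $S(x)=(S_{zy}(x))_{z,y\sim x}$ of size $d_x$. Let $\mathcal I$ be the family of identity matrices, and let $\|\mathcal S-\mathcal I\|:=\sup_{x\in V}\|S(x)-\mathbb 1\|_{HS}$, where $\|\cdot\|_{HS}$ is the Hilbert–Schmidt norm. Let $\mu$ be a probability measure on the torus $\mathbb T=\mathbb R/2\pi\mathbb Z$ of the form $d\mu(\theta)=\tau(\theta)\,d\theta$ with $\tau\in L^\infty(\mathbb T)$, and let $(\omega_x)_{x\in V}$ be i.i.d. random variables with law $\mu$. The random scattering quantum walk with scattering matrices $\mathcal S$ is the random unitary operator $U=U_\omega$ on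 $\ell^2(D)$ given by $$U_\omega|xy\rangle=e^{i\omega_x}\sum_{z\sim x}S_{zy}(x)\,|zx\rangle .$$ Theorem. For every $s\in(0,1/3)$ and every $g>0$ there exist $\varphi,c>0$ such that for every family of scattering matrices $\mathcal S$ with $\|\mathcal S-\mathcal I\|\le\varphi$ and all $(xy),(x'y')\in D$, $$\sup_{|z|\in[1/2,3/2]\setminus\{1\}}\mathbb E\Big[\big|\langle xy|(U-z)^{-1}|x'y'\rangle\big|^s\Big]\le c\,e^{-g\,\operatorname{d}(x,x')} .$$ -/

import Mathlib

open MeasureTheory ProbabilityTheory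
open scoped ENNReal

namespace ScatteringWalk

instance fact_two_pi_pos : Fact (0 < 2 * Real.pi) := ⟨Real.two_pi_pos⟩

/-- The torus `ℝ / 2πℤ`. Its `volume` is the Lebesgue measure `dθ`, of total mass `2π`. -/
abbrev Torus : Type := AddCircle (2 * Real.pi)

/-- The phase `exp (iθ)` of a point `θ` of the torus. -/
noncomputable def phase (θ : Torus) : Circle := AddCircle.toCircle θ

theorem phase_coe (θ : ℝ) : (phase (θ : Torus) : ℂ) = Complex.exp (θ * Complex.I) := by
  rw [phase, AddCircle.toCircle_apply_mk, Circle.coe_exp,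
    div_self (ne_of_gt Real.two_pi_pos), one_mul]

/-- The law on the torus with density `τ` with respect to `dθ`. -/
noncomputable def lawOfDensity (τ : Torus → ℝ) : Measure Torus :=
  volume.withDensity (fun θ => ENNReal.ofReal (τ θ))

variable {V : Type*} (G : SimpleGraph V)

/-- The Hilbert space `ℓ²(D)` over the directed edges `D` of the graph. A directed edge is a dart
`e`, which goes from `e.fst` to `e.snd`; the basis vector `|xy⟩` of the edge from `y` to `x`
belongs to the dart `e` with `e.snd = x` and `e.fst = y`. -/
abbrev EdgeSpace : Type _ := lp (fun _ : G.Dart => ℂ) 2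

variable {G}

/-- The canonical basis vector of a directed edge. -/
noncomputable def ket [DecidableEq V] (e : G.Dart) : EdgeSpace G :=
  lp.single 2 e (1 : ℂ)

/-- A directed edge is the same as its starting vertex `x` together with a neighbour of `x`. -/
def dartEquiv : G.Dart ≃ (Σ x : V, G.neighborSet x) where
  toFun e := ⟨e.fst, ⟨e.snd, e.adj⟩⟩
  invFun p := G.dartOfNeighborSet p.1 p.2
  left_inv _ := rfl
  right_inv _ := rfl

/-- Reversal of directed edges. -/
def dartSymm : G.Dart ≃ G.Dart where
  toFun := SimpleGraph.Dart.symm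
  invFun := SimpleGraph.Dart.symm
  left_inv e := e.symm_symm
  right_inv e := e.symm_symm

variable [DecidableEq V] [G.LocallyFinite]

variable (G) in
/-- A family `S = (S(x))` of scattering matrices: for every vertex `x` a unitary matrix whose rows
and columns are labelled by the neighbours of `x`. -/
abbrev ScatteringFamily : Type _ := ∀ x : V, Matrix.unitaryGroup (G.neighborSet x) ℂ

/-- The action of the scattering quantum walk on functions on directed edges:
`(U ψ)(x → z) = ∑_{y ∼ x} S_{zy}(x) ψ(y → x)`. -/
noncomputable def scatter (S : ScatteringFamily G) (ψ : G.Dart → ℂ) : G.Dart → ℂ := fun e =>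
  ∑ y : G.neighborSet e.fst,
    (S e.fst : Matrix (G.neighborSet e.fst) (G.neighborSet e.fst) ℂ) ⟨e.snd, e.adj⟩ y *
      ψ (G.dartOfNeighborSet e.fst y).symm

theorem sum_enorm_sq_mulVec {n : Type*} [Fintype n] [DecidableEq n]
    (A : Matrix.unitaryGroup n ℂ) (v : n → ℂ) :
    ∑ i, ‖∑ j, (A : Matrix n n ℂ) i j * v j‖ₑ ^ 2 = ∑ i, ‖v i‖ₑ ^ 2 := by
  have key : ∀ w : n → ℂ, ∑ i, ‖w i‖ₑ ^ 2 = ENNReal.ofReal (star w ⬝ᵥ w).re := by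
    intro w
    have h1 : (star w ⬝ᵥ w).re = ∑ i, ‖w i‖ ^ 2 := by
      simp only [dotProduct, Pi.star_apply, Complex.re_sum]
      refine Finset.sum_congr rfl fun i _ => ?_
      rw [← Complex.normSq_eq_norm_sq, Complex.normSq_apply]
      simp
    rw [h1, ENNReal.ofReal_sum_of_nonneg fun i _ => by positivity]
    refine Finset.sum_congr rfl fun i _ => ?_
    rw [ENNReal.ofReal_pow (norm_nonneg _), ofReal_norm]
  have h2 : star ((A : Matrix n n ℂ).mulVec v) ⬝ᵥ ((A : Matrix n n ℂ).mulVec v)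
      = star v ⬝ᵥ v := by
    rw [Matrix.star_mulVec, Matrix.dotProduct_mulVec, Matrix.vecMul_vecMul,
      ← Matrix.star_eq_conjTranspose, Matrix.UnitaryGroup.star_mul_self, Matrix.vecMul_one]
  have h3 := key ((A : Matrix n n ℂ).mulVec v)
  rw [h2, ← key v] at h3
  exact h3

theorem tsum_enorm_sq_scatter (S : ScatteringFamily G) (ψ : G.Dart → ℂ) :
    ∑' e, ‖scatter S ψ e‖ₑ ^ 2 = ∑' e, ‖ψ e‖ₑ ^ 2 := by
  calc ∑' e, ‖scatter S ψ e‖ₑ ^ 2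
      = ∑' x : V, ∑' z : G.neighborSet x, ‖scatter S ψ (G.dartOfNeighborSet x z)‖ₑ ^ 2 := by
        rw [← ENNReal.tsum_sigma, ← dartEquiv.symm.tsum_eq]
        rfl
    _ = ∑' x : V, ∑' y : G.neighborSet x, ‖ψ (G.dartOfNeighborSet x y).symm‖ₑ ^ 2 := by
        refine tsum_congr fun x => ?_
        rw [tsum_fintype, tsum_fintype]
        exact sum_enorm_sq_mulVec (S x) fun y => ψ (G.dartOfNeighborSet x y).symm
    _ = ∑' e : G.Dart, ‖ψ e.symm‖ₑ ^ 2 := by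
        rw [← ENNReal.tsum_sigma, ← dartEquiv.symm.tsum_eq]
        rfl
    _ = ∑' e, ‖ψ e‖ₑ ^ 2 := dartSymm.tsum_eq fun e => ‖ψ e‖ₑ ^ 2

theorem memlp_iff_tsum_enorm {ι : Type*} (f : ι → ℂ) :
    Memℓp f 2 ↔ ∑' i, ‖f i‖ₑ ^ 2 ≠ ∞ := by
  have h : ∀ i, ‖f i‖ₑ ^ 2 = ENNReal.ofReal (‖f i‖ ^ 2) := fun i => by
    rw [ENNReal.ofReal_pow (norm_nonneg _), ofReal_norm]
  rw [memℓp_gen_iff (by norm_num)]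
  simp only [h, ENNReal.toReal_ofNat, Real.rpow_ofNat]
  constructor
  · intro hs
    rw [← ENNReal.ofReal_tsum_of_nonneg (fun _ => by positivity) hs]
    exact ENNReal.ofReal_ne_top
  · intro ht
    have := ENNReal.summable_toReal ht
    simpa [ENNReal.toReal_ofReal, sq_nonneg] using this

theorem norm_sq_eq_tsum_enorm {ι : Type*} (f : lp (fun _ : ι => ℂ) 2) :
    ‖f‖ ^ 2 = (∑' i, ‖f i‖ₑ ^ 2).toReal := by
  have h := lp.norm_rpow_eq_tsum (p := 2) (by norm_num) f
  simp only [ENNReal.toReal_ofNat, Real.rpow_ofNat] at h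
  rw [h, ENNReal.tsum_toReal_eq fun i => by simp]
  simp

/-- The adjoint family of scattering matrices. -/
noncomputable def adjointFamily (S : ScatteringFamily G) : ScatteringFamily G := fun x => star (S x)

/-- The action of the adjoint of the walk on functions on directed edges. -/
noncomputable def scatterAdjoint (S : ScatteringFamily G) (ψ : G.Dart → ℂ) : G.Dart → ℂ :=
  fun e => scatter (adjointFamily S) (fun e' => ψ e'.symm) e.symm

theorem scatterAdjoint_scatter (S : ScatteringFamily G) (ψ : G.Dart → ℂ) :
    scatterAdjoint S (scatter S ψ) = ψ := by
  have h : ∀ (x : V) (y : G.neighborSet x),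
      scatterAdjoint S (scatter S ψ) (G.dartOfNeighborSet x y).symm
        = ψ (G.dartOfNeighborSet x y).symm := by
    intro x y
    have h1 : Matrix.mulVec (star (S x : Matrix (G.neighborSet x) (G.neighborSet x) ℂ))
        (Matrix.mulVec (S x : Matrix (G.neighborSet x) (G.neighborSet x) ℂ)
          fun y => ψ (G.dartOfNeighborSet x y).symm) y = ψ (G.dartOfNeighborSet x y).symm := by
      rw [Matrix.mulVec_mulVec, Matrix.UnitaryGroup.star_mul_self, Matrix.one_mulVec]
    exact h1
  funext e
  exact h e.snd ⟨e.fst, e.adj.symm⟩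

theorem scatter_scatterAdjoint (S : ScatteringFamily G) (ψ : G.Dart → ℂ) :
    scatter S (scatterAdjoint S ψ) = ψ := by
  have h : ∀ (x : V) (z : G.neighborSet x),
      scatter S (scatterAdjoint S ψ) (G.dartOfNeighborSet x z)
        = ψ (G.dartOfNeighborSet x z) := by
    intro x z
    have h1 : Matrix.mulVec (S x : Matrix (G.neighborSet x) (G.neighborSet x) ℂ)
        (Matrix.mulVec (star (S x : Matrix (G.neighborSet x) (G.neighborSet x) ℂ))
          fun z => ψ (G.dartOfNeighborSet x z)) z = ψ (G.dartOfNeighborSet x z) := by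
      rw [Matrix.mulVec_mulVec]
      have : (S x : Matrix (G.neighborSet x) (G.neighborSet x) ℂ) * star (S x).1 = 1 :=
        Unitary.mul_star_self_of_mem (S x).2
      rw [this, Matrix.one_mulVec]
    exact h1
  funext e
  exact h e.fst ⟨e.snd, e.adj⟩

theorem tsum_enorm_sq_scatterAdjoint (S : ScatteringFamily G) (ψ : G.Dart → ℂ) :
    ∑' e, ‖scatterAdjoint S ψ e‖ₑ ^ 2 = ∑' e, ‖ψ e‖ₑ ^ 2 := by
  rw [← tsum_enorm_sq_scatter S (scatterAdjoint S ψ), scatter_scatterAdjoint]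

/-- The scattering quantum walk `U_S`, a unitary operator on `ℓ²(D)`. -/
noncomputable def walk (S : ScatteringFamily G) : EdgeSpace G ≃ₗᵢ[ℂ] EdgeSpace G where
  toFun ψ := ⟨scatter S ψ, (memlp_iff_tsum_enorm _).2
    ((tsum_enorm_sq_scatter S ψ).trans_ne ((memlp_iff_tsum_enorm _).1 ψ.2))⟩
  invFun ψ := ⟨scatterAdjoint S ψ, (memlp_iff_tsum_enorm _).2
    ((tsum_enorm_sq_scatterAdjoint S ψ).trans_ne ((memlp_iff_tsum_enorm _).1 ψ.2))⟩
  map_add' ψ χ := by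
    ext e
    simp only [scatter, lp.coeFn_add, Pi.add_apply, mul_add, Finset.sum_add_distrib]
  map_smul' c ψ := by
    ext e
    simp [scatter, Finset.mul_sum, mul_left_comm]
  left_inv ψ := by
    ext e
    exact congrFun (scatterAdjoint_scatter S ψ) e
  right_inv ψ := by
    ext e
    exact congrFun (scatter_scatterAdjoint S ψ) e
  norm_map' ψ := by
    rw [← sq_eq_sq₀ (norm_nonneg _) (norm_nonneg _), norm_sq_eq_tsum_enorm, norm_sq_eq_tsum_enorm]
    exact congrArg ENNReal.toReal (tsum_enorm_sq_scatter S ψ)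

/-- `U_S |xy⟩ = ∑_{z ∼ x} S_{zy}(x) |zx⟩`. -/
theorem walk_ket (S : ScatteringFamily G) (e : G.Dart) :
    walk S (ket e) = ∑ z : G.neighborSet e.snd,
      (S e.snd : Matrix (G.neighborSet e.snd) (G.neighborSet e.snd) ℂ) z ⟨e.fst, e.adj.symm⟩ •
        ket (G.dartOfNeighborSet e.snd z) := by
  obtain ⟨⟨y₀, x₀⟩, h⟩ := e
  ext e'
  obtain ⟨⟨x, z⟩, h'⟩ := e'
  rw [lp.coeFn_sum, Finset.sum_apply]
  change ∑ y : G.neighborSet x, (S x).1 ⟨z, h'⟩ y *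
    (lp.single 2 _ (1 : ℂ) : EdgeSpace G) (G.dartOfNeighborSet x y).symm =
    ∑ w : G.neighborSet x₀, (S x₀).1 w ⟨y₀, h.symm⟩ *
      (lp.single 2 (G.dartOfNeighborSet x₀ w) (1 : ℂ) : EdgeSpace G) ⟨(x, z), h'⟩
  simp only [lp.coeFn_single, Pi.single_apply, mul_ite, mul_one, mul_zero]
  by_cases hx : x = x₀
  · subst hx
    rw [Finset.sum_eq_single_of_mem ⟨y₀, h.symm⟩ (Finset.mem_univ _),
      Finset.sum_eq_single_of_mem ⟨z, h'⟩ (Finset.mem_univ _)]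
    · simp [SimpleGraph.dartOfNeighborSet, SimpleGraph.Dart.symm]
    · intro w _ hw
      refine if_neg fun h2 => hw ?_
      exact Subtype.ext (congrArg (fun e : G.Dart => e.snd) h2).symm
    · intro w _ hw
      refine if_neg fun h2 => hw ?_
      exact Subtype.ext (congrArg (fun e : G.Dart => e.fst) h2)
  · rw [Finset.sum_eq_zero, Finset.sum_eq_zero]
    · intro w _
      exact if_neg fun h2 => hx (congrArg (fun e : G.Dart => e.fst) h2)
    · intro w _
      exact if_neg fun h2 => hx (congrArg (fun e : G.Dart => e.snd) h2)

/-- The family `S_ω(x) = exp (iω_x) S(x)`, for phases `ω = (ω_x)` on the vertices. -/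
noncomputable def dressed (S : ScatteringFamily G) (ω : V → Torus) : ScatteringFamily G := fun x =>
  ⟨((phase (ω x) : Circle) : ℂ) • (S x : Matrix (G.neighborSet x) (G.neighborSet x) ℂ), by
    rw [Matrix.mem_unitaryGroup_iff, star_smul, smul_mul_smul_comm,
      Unitary.mul_star_self_of_mem (S x).2]
    have : ((phase (ω x) : Circle) : ℂ) * star ((phase (ω x) : Circle) : ℂ) = 1 := by
      rw [Complex.star_def, Complex.mul_conj, Circle.normSq_coe, Complex.ofReal_one]
    rw [this, one_smul]⟩

/-- The walk `U_ω = U_{S_ω}` as a bounded operator on `ℓ²(D)`. -/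
noncomputable def walkOp (S : ScatteringFamily G) (ω : V → Torus) :
    EdgeSpace G →L[ℂ] EdgeSpace G :=
  ((walk (dressed S ω)).toContinuousLinearEquiv : EdgeSpace G →L[ℂ] EdgeSpace G)

/-- Off the unit circle the resolvent exists. -/
theorem isUnit_walkOp_sub (S : ScatteringFamily G) (ω : V → Torus) {z : ℂ} (hz : ‖z‖ ≠ 1) :
    IsUnit (walkOp S ω - z • 1) := by
  have hU : walkOp S ω ∈ unitary (EdgeSpace G →L[ℂ] EdgeSpace G) :=
    (Unitary.linearIsometryEquiv.symm (walk (dressed S ω))).2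
  by_contra h
  have h1 : z ∈ spectrum ℂ (walkOp S ω) := by
    rw [spectrum.mem_iff, Algebra.algebraMap_eq_smul_one]
    rwa [← IsUnit.neg_iff, neg_sub] at h
  exact hz (mem_sphere_zero_iff_norm.1 (Unitary.spectrum_subset_circle ⟨_, hU⟩ h1))

/-- The matrix element `⟨e| (U_ω - z)⁻¹ |e'⟩` of the resolvent. -/
noncomputable def green (S : ScatteringFamily G) (ω : V → Torus) (z : ℂ) (e e' : G.Dart) : ℂ :=
  inner ℂ (ket e) (Ring.inverse (walkOp S ω - z • 1) (ket e'))

/-- The Hilbert–Schmidt norm of a matrix. -/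
noncomputable def hsNorm {n : Type*} [Fintype n] (A : Matrix n n ℂ) : ℝ :=
  Real.sqrt (∑ i, ∑ j, ‖A i j‖ ^ 2)

/-- The distance `‖S - S'‖ = sup_x ‖S(x) - S'(x)‖_HS` of two families of scattering matrices. -/
noncomputable def scatteringDist (S S' : ScatteringFamily G) : ℝ≥0∞ :=
  ⨆ x : V, ENNReal.ofReal (hsNorm
    ((S x : Matrix (G.neighborSet x) (G.neighborSet x) ℂ) -
      (S' x : Matrix (G.neighborSet x) (G.neighborSet x) ℂ)))

variable (G) in
/-- The family of identity matrices. -/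
noncomputable def idFamily : ScatteringFamily G := fun _ => 1

/-- `exp (-g n)` for a graph distance `n`, with `exp (-g ∞) = 0`. -/
noncomputable def expDecay (g : ℝ) (n : ℕ∞) : ℝ :=
  if n = ⊤ then 0 else Real.exp (-g * (n.toNat : ℝ))

end ScatteringWalk

/-! The proof is a fractional moment argument, carried out first for `‖z‖ > 1`. The phases are
relaxed to arbitrary numbers `a x` in the closed unit disc, which turns the walk into a contraction
`contr S a` that is affine in each `a x`; its resolvent `res S a z` exists and is holomorphic in
each of these variables.

A priori bound: `herglotz` has positive real part, so by Kolmogorov's inequality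
(`lintegral_rpow_enorm_le_of_re_pos`) averaging one phase costs a constant and replaces that phase
by `0`. Once the phases at the starting vertices of the support of `φ` are `0`, the function equals
`‖φ‖ ^ 2`. Polarization then bounds the `t`-th moments of all matrix elements, `t < 1`, uniformly in
`z` and even conditionally on the other phases (`lintegral_res_piecewise_le`).

Decay: for identity scattering matrices the walk only bounces along each edge, and the resolvent
splits into blocks of size two with determinant `denom`. For nearby matrices, `norm_res_le_denom`
bounds a matrix element by `r / |denom|` times matrix elements at neighbouring edges. The
denominator and these elements are correlated. To decouple them, the phases near the edge are
resampled and the new resolvent is compared with the old one by the resolvent identity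
(`norm_res_le_of_eqOn`); Cauchy–Schwarz then asks for moments of order `2 * s < 1`. The outcome,
`moment_le_of_surroundings`, gains a small factor per step of length at most two, and
`moment_le_pow` iterates it.

The case `‖z‖ < 1` follows from unitarity through `green_eq_conj`. -/

namespace ScatteringWalk

/-! ### Contractions with disc-valued modulations and their resolvents -/

section

/-- The closed unit disc. -/
abbrev Disc : Type := Metric.closedBall (0 : ℂ) 1

instance : Zero Disc := ⟨⟨0, by simp⟩⟩

theorem Disc.coe_zero : ((0 : Disc) : ℂ) = 0 := rfl

theorem Disc.norm_le_one (w : Disc) : ‖(w : ℂ)‖ ≤ 1 := mem_closedBall_zero_iff.1 w.2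

/-- The point of the unit circle with a given phase, as a point of the disc. -/
noncomputable def phaseDisc (θ : Torus) : Disc :=
  ⟨(phase θ : ℂ), by rw [mem_closedBall_zero_iff, Circle.norm_coe]⟩

theorem measurable_phaseDisc : Measurable phaseDisc := by
  refine Measurable.subtype_mk ?_
  exact (continuous_subtype_val.comp AddCircle.continuous_toCircle).measurable

variable {V : Type*} {G : SimpleGraph V}

/-- Multiplication of `ψ ∈ ℓ²(D)` by a function in the unit ball which depends only on the starting
vertex of an edge. -/
noncomputable def modulate (a : V → Disc) : EdgeSpace G →L[ℂ] EdgeSpace G :=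
  LinearMap.mkContinuous
    { toFun := fun ψ => ⟨fun e => (a e.fst : ℂ) * ψ e, (lp.memℓp ψ).mono' fun e => by
        rw [norm_mul]
        exact mul_le_of_le_one_left (norm_nonneg _) (a e.fst).norm_le_one⟩
      map_add' := fun ψ χ => by
        ext e
        exact mul_add _ _ _
      map_smul' := fun c ψ => by
        ext e
        simp [mul_left_comm] } 1 fun ψ => by
    rw [one_mul]
    refine lp.norm_mono (by norm_num) fun e => ?_
    change ‖(a e.fst : ℂ) * ψ e‖ ≤ _
    rw [norm_mul]
    exact mul_le_of_le_one_left (norm_nonneg _) (a e.fst).norm_le_one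

theorem norm_modulate_le (a : V → Disc) : ‖(modulate a : EdgeSpace G →L[ℂ] EdgeSpace G)‖ ≤ 1 :=
  LinearMap.mkContinuous_norm_le _ zero_le_one _

variable [DecidableEq V]

theorem ket_apply_self (e : G.Dart) : (ket e : EdgeSpace G) e = 1 := lp.single_apply_self _ _ _

theorem ket_apply_ne {e e' : G.Dart} (h : e ≠ e') : (ket e' : EdgeSpace G) e = 0 :=
  lp.single_apply_ne _ _ _ h

theorem norm_ket (e : G.Dart) : ‖(ket e : EdgeSpace G)‖ = 1 := by
  rw [ket, lp.norm_single (by norm_num), norm_one]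

theorem inner_ket_left (e : G.Dart) (ψ : EdgeSpace G) : inner ℂ (ket e) ψ = ψ e := by
  rw [ket, lp.inner_single_left]
  simp

variable [G.LocallyFinite]

/-- The contraction obtained from the walk `U_S` by multiplication with numbers in the unit disc at
the vertices. -/
noncomputable def contr (S : ScatteringFamily G) (a : V → Disc) : EdgeSpace G →L[ℂ] EdgeSpace G :=
  modulate a ∘L ((walk S).toContinuousLinearEquiv : EdgeSpace G →L[ℂ] EdgeSpace G)

theorem contr_apply (S : ScatteringFamily G) (a : V → Disc) (ψ : EdgeSpace G) (e : G.Dart) :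
    contr S a ψ e = (a e.fst : ℂ) * scatter S ψ e := rfl

theorem norm_contr_apply_le (S : ScatteringFamily G) (a : V → Disc) (ψ : EdgeSpace G) :
    ‖contr S a ψ‖ ≤ ‖ψ‖ := by
  calc ‖contr S a ψ‖ ≤ 1 * ‖walk S ψ‖ := (modulate a).le_of_opNorm_le (norm_modulate_le a) _
    _ = ‖ψ‖ := by rw [one_mul, LinearIsometryEquiv.norm_map]

theorem walkOp_eq_contr (S : ScatteringFamily G) (ω : V → Torus) :
    walkOp S ω = contr S fun x => phaseDisc (ω x) := by
  ext ψ e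
  change scatter (dressed S ω) ψ e = (phase (ω e.fst) : ℂ) * scatter S ψ e
  simp only [scatter, dressed, Finset.mul_sum, Matrix.smul_apply, smul_eq_mul, mul_assoc]

theorem isUnit_contr_sub (S : ScatteringFamily G) (a : V → Disc) {z : ℂ} (hz : 1 < ‖z‖) :
    IsUnit (contr S a - z • 1) := by
  have h1 : ‖contr S a‖ ≤ 1 :=
    ContinuousLinearMap.opNorm_le_bound _ zero_le_one fun ψ => by
      rw [one_mul]; exact norm_contr_apply_le S a ψ
  have h2 : ‖(1 : EdgeSpace G →L[ℂ] EdgeSpace G)‖ ≤ 1 := ContinuousLinearMap.norm_id_le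
  have h3 : z ∈ resolventSet ℂ (contr S a) := spectrum.mem_resolventSet_of_norm_lt_mul
    ((mul_le_one₀ h1 (norm_nonneg _) h2).trans_lt hz)
  rw [spectrum.mem_resolventSet_iff, Algebra.algebraMap_eq_smul_one] at h3
  rwa [← IsUnit.neg_iff, neg_sub]

/-- The resolvent of `contr S a`. -/
noncomputable def res (S : ScatteringFamily G) (a : V → Disc) (z : ℂ) :
    EdgeSpace G →L[ℂ] EdgeSpace G :=
  Ring.inverse (contr S a - z • 1)

theorem contr_res (S : ScatteringFamily G) (a : V → Disc) {z : ℂ} (hz : 1 < ‖z‖) (ψ : EdgeSpace G) :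
    contr S a (res S a z ψ) = z • res S a z ψ + ψ := by
  have h := DFunLike.congr_fun (Ring.mul_inverse_cancel _ (isUnit_contr_sub S a hz)) ψ
  change contr S a (res S a z ψ) - z • res S a z ψ = ψ at h
  rw [add_comm]
  exact sub_eq_iff_eq_add.1 h

theorem res_contr (S : ScatteringFamily G) (a : V → Disc) {z : ℂ} (hz : 1 < ‖z‖) (ψ : EdgeSpace G) :
    res S a z (contr S a ψ) = z • res S a z ψ + ψ := by
  have h := DFunLike.congr_fun (Ring.inverse_mul_cancel _ (isUnit_contr_sub S a hz)) ψ
  change res S a z (contr S a ψ - z • ψ) = ψ at h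
  rw [map_sub, map_smul, sub_eq_iff_eq_add] at h
  rw [h, add_comm]

theorem green_eq (S : ScatteringFamily G) (ω : V → Torus) (z : ℂ) (e e' : G.Dart) :
    green S ω z e e' = res S (fun x => phaseDisc (ω x)) z (ket e') e := by
  rw [green, inner_ket_left, walkOp_eq_contr]
  rfl

/-- The resolvent identity for two modulations which differ on a finite set of vertices. -/
theorem res_sub_res (S : ScatteringFamily G) (a b : V → Disc) {z : ℂ} (hz : 1 < ‖z‖)
    (ψ : EdgeSpace G) :
    res S a z ψ = res S b z ψ - res S a z (contr S a (res S b z ψ) - contr S b (res S b z ψ)) := by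
  rw [contr_res S b hz, map_sub, res_contr S a hz, map_add, map_smul]
  abel

/-- The resolvent vector is the limit of the contractive iteration `ψ ↦ z⁻¹ • (contr S a ψ - ket
e')` started at `0`. By local finiteness each coordinate of an iterate is a finite expression in
coordinates of `a`, so it is measurable for the product σ-algebra whatever the size of `V`. -/
theorem measurable_res (S : ScatteringFamily G) {z : ℂ} (hz : 1 < ‖z‖) (e e' : G.Dart) :
    Measurable fun a : V → Disc => res S a z (ket e') e := by
  let u : ℕ → (V → Disc) → EdgeSpace G := fun n a =>
    Nat.rec 0 (fun _ ψ => z⁻¹ • (contr S a ψ - ket e')) n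
  have hz0 : z ≠ 0 := norm_pos_iff.1 (by linarith)
  have hu : ∀ n a, u (n + 1) a = z⁻¹ • (contr S a (u n a) - ket e') := fun n a => rfl
  have hm : ∀ n f, Measurable fun a => u n a f := by
    intro n
    induction n with
    | zero => intro f; exact measurable_const
    | succ n ih =>
      intro f
      have h : (fun a => u (n + 1) a f) =
          fun a => z⁻¹ * ((a f.fst : ℂ) * scatter S (u n a) f - (ket e' : EdgeSpace G) f) := by
        funext a
        rw [hu]; rfl
      rw [h]
      simp only [scatter]
      refine (((measurable_subtype_coe.comp (measurable_pi_apply _)).mul ?_).sub_const _).const_mul _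
      exact Finset.measurable_sum _ fun y _ => (ih _).const_mul _
  have hd : ∀ n a, ‖u n a - res S a z (ket e')‖ ≤ ‖z⁻¹‖ ^ n * ‖res S a z (ket e')‖ := by
    intro n a
    induction n with
    | zero => simp [u]
    | succ n ih =>
      have h1 : u (n + 1) a - res S a z (ket e')
          = z⁻¹ • contr S a (u n a - res S a z (ket e')) := by
        rw [hu, map_sub, contr_res S a hz, smul_sub, smul_sub, smul_add, inv_smul_smul₀ hz0]
        abel
      rw [h1, norm_smul, pow_succ', mul_assoc]
      exact mul_le_mul_of_nonneg_left ((norm_contr_apply_le S a _).trans ih) (norm_nonneg _)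
  refine measurable_of_tendsto_metrizable (hm · e) (tendsto_pi_nhds.2 fun a => ?_)
  rw [tendsto_iff_norm_sub_tendsto_zero]
  have h0 : Filter.Tendsto (fun n => ‖z⁻¹‖ ^ n * ‖res S a z (ket e')‖) Filter.atTop (nhds 0) := by
    have := (tendsto_pow_atTop_nhds_zero_of_lt_one (norm_nonneg z⁻¹)
      (by rw [norm_inv]; exact inv_lt_one_of_one_lt₀ hz)).mul_const ‖res S a z (ket e')‖
    rwa [zero_mul] at this
  refine squeeze_zero (fun _ => norm_nonneg _) (fun n => ?_) h0
  exact (lp.norm_apply_le_norm (by norm_num) (u n a - res S a z (ket e')) e).trans (hd n a)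

end

/-! ### Kolmogorov's inequality and resampling in product measures -/

section

/-- Kolmogorov's inequality: the moments of order `t < 1` on the unit circle of a holomorphic
function with positive real part are controlled by its value at the centre. -/
theorem lintegral_rpow_enorm_le_of_re_pos {h : ℂ → ℂ}
    (hd : ∀ w ∈ Metric.closedBall (0 : ℂ) 1, DifferentiableAt ℂ h w)
    (hre : ∀ w ∈ Metric.closedBall (0 : ℂ) 1, 0 < (h w).re) {t : ℝ} (ht0 : 0 < t) (ht1 : t < 1) :
    ∫⁻ θ : Torus, ‖h (phase θ)‖ₑ ^ t
      ≤ ENNReal.ofReal (2 * Real.pi / Real.cos (t * (Real.pi / 2))) * ‖h 0‖ₑ ^ t := by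
  have hpi := Real.pi_pos
  have hcos : 0 < Real.cos (t * (Real.pi / 2)) :=
    Real.cos_pos_of_mem_Ioo ⟨by nlinarith, by nlinarith⟩
  -- Since `|arg h| ≤ π / 2`, the power `f = h ^ t` satisfies `cos (t * π / 2) * ‖h‖ ^ t ≤ re f`;
  -- the circle mean of `re f` is its value at the centre.
  set f : ℂ → ℂ := fun w => h w ^ (t : ℂ) with hf
  have hfd : ∀ w ∈ Metric.closedBall (0 : ℂ) 1, DifferentiableAt ℂ f w := fun w hw =>
    (hd w hw).cpow_const (Or.inl (hre w hw))
  have hnorm : ∀ w ∈ Metric.closedBall (0 : ℂ) 1, ‖f w‖ = ‖h w‖ ^ t := fun w hw => by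
    have h0 : h w ≠ 0 := fun h0 => by simpa [h0] using hre w hw
    rw [hf, Complex.norm_cpow_of_ne_zero h0]
    simp
  have hbd : ∀ w ∈ Metric.closedBall (0 : ℂ) 1,
      Real.cos (t * (Real.pi / 2)) * ‖h w‖ ^ t ≤ (f w).re := by
    intro w hw
    have h0 : h w ≠ 0 := fun h0 => by simpa [h0] using hre w hw
    have harg : |Complex.arg (h w)| ≤ Real.pi / 2 :=
      Complex.abs_arg_le_pi_div_two_iff.2 (hre w hw).le
    have h1 : (f w).re = ‖h w‖ ^ t * Real.cos (t * Complex.arg (h w)) := by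
      rw [hf]
      change (h w ^ (t : ℂ)).re = _
      rw [Complex.cpow_ofReal_re, mul_comm t]
    rw [h1, mul_comm]
    refine mul_le_mul_of_nonneg_left ?_ (by positivity)
    rw [← Real.cos_abs (t * Complex.arg (h w)), abs_mul, abs_of_pos ht0]
    refine Real.cos_le_cos_of_nonneg_of_le_pi (by positivity) (by nlinarith) ?_
    exact mul_le_mul_of_nonneg_left harg ht0.le
  have hmem : ∀ θ : ℝ, circleMap 0 1 θ ∈ Metric.closedBall (0 : ℂ) 1 := fun θ =>
    circleMap_mem_closedBall 0 zero_le_one θ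
  have hphase : ∀ θ : ℝ, (phase (θ : Torus) : ℂ) = circleMap 0 1 θ := fun θ => by
    rw [phase_coe, circleMap]; simp
  have hcf : Continuous fun θ : ℝ => f (circleMap 0 1 θ) :=
    continuous_iff_continuousAt.2 fun θ => (hfd _ (hmem θ)).continuousAt.comp
      (continuous_circleMap 0 1).continuousAt
  have hch : Continuous fun θ : ℝ => ‖h (circleMap 0 1 θ)‖ ^ t :=
    hcf.norm.congr fun θ => hnorm _ (hmem θ)
  have hmean : Real.circleAverage f 0 1 = f 0 := by
    refine DiffContOnCl.circleAverage (DifferentiableOn.diffContOnCl ?_)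
    intro w hw
    refine (hfd w ?_).differentiableWithinAt
    rwa [abs_one, closure_ball _ one_ne_zero] at hw
  have hint : ∫ θ in (0 : ℝ)..2 * Real.pi, (f (circleMap 0 1 θ)).re = 2 * Real.pi * (f 0).re := by
    rw [← hmean, Real.circleAverage_def, Complex.smul_re, smul_eq_mul,
      mul_inv_cancel_left₀ (by positivity)]
    exact Complex.reCLM.intervalIntegral_comp_comm (hcf.intervalIntegrable _ _)
  have hle : ∫ θ in (0 : ℝ)..2 * Real.pi, ‖h (circleMap 0 1 θ)‖ ^ t
      ≤ 2 * Real.pi / Real.cos (t * (Real.pi / 2)) * ‖h 0‖ ^ t := by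
    calc ∫ θ in (0 : ℝ)..2 * Real.pi, ‖h (circleMap 0 1 θ)‖ ^ t
        ≤ ∫ θ in (0 : ℝ)..2 * Real.pi,
          (Real.cos (t * (Real.pi / 2)))⁻¹ * (f (circleMap 0 1 θ)).re := by
          refine intervalIntegral.integral_mono_on (by positivity) (hch.intervalIntegrable _ _)
            ((continuous_const.mul (Complex.continuous_re.comp hcf)).intervalIntegrable _ _) ?_
          intro θ _
          rw [le_inv_mul_iff₀ hcos]
          exact hbd _ (hmem θ)
      _ = 2 * Real.pi / Real.cos (t * (Real.pi / 2)) * (f 0).re := by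
          rw [intervalIntegral.integral_const_mul, hint]
          ring
      _ ≤ _ := by
          refine mul_le_mul_of_nonneg_left ?_ (by positivity)
          rw [← hnorm 0 (by simp)]
          exact Complex.re_le_norm _
  have hen : ∀ w, ‖h w‖ₑ ^ t = ENNReal.ofReal (‖h w‖ ^ t) := fun w => by
    rw [← ofReal_norm, ENNReal.ofReal_rpow_of_nonneg (norm_nonneg _) ht0.le]
  rw [← AddCircle.lintegral_preimage (2 * Real.pi) 0, zero_add]
  simp only [hphase, hen]
  rw [← ofReal_integral_eq_lintegral_ofReal, ← intervalIntegral.integral_of_le (by positivity),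
    ← ENNReal.ofReal_mul (by positivity)]
  · exact ENNReal.ofReal_le_ofReal hle
  · exact (hch.intervalIntegrable 0 (2 * Real.pi)).1
  · exact Filter.Eventually.of_forall fun θ => by positivity

theorem lawOfDensity_le {τ : Torus → ℝ} (hτ : MemLp τ ∞ volume) :
    ∃ C : ℝ≥0∞, C ≠ ∞ ∧ lawOfDensity τ ≤ C • volume := by
  refine ⟨eLpNorm τ ∞ volume, hτ.2.ne, ?_⟩
  rw [lawOfDensity, ← withDensity_const]
  refine withDensity_mono ?_
  rw [eLpNorm_exponent_top]
  filter_upwards [ae_le_eLpNormEssSup (f := τ) (μ := volume)] with θ hθ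
  refine le_trans ?_ hθ
  rw [← ofReal_norm]
  exact ENNReal.ofReal_le_ofReal (Real.le_norm_self _)

/-- Resampling finitely many coordinates does not change a product measure. -/
theorem lintegral_infinitePi_eq_piecewise {ι X : Type*} [MeasurableSpace X] [DecidableEq ι]
    (μ : Measure X) [IsProbabilityMeasure μ] (F : Finset ι) {H : (ι → X) → ℝ≥0∞}
    (hH : Measurable H) :
    ∫⁻ ω, H ω ∂Measure.infinitePi (fun _ : ι => μ) =
      ∫⁻ ω, ∫⁻ ζ, H (F.piecewise ζ ω) ∂Measure.infinitePi (fun _ : ι => μ)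
        ∂Measure.infinitePi (fun _ : ι => μ) := by
  set Q := Measure.infinitePi (fun _ : ι => μ) with hQ
  have hpw : Measurable fun p : (ι → X) × (ι → X) => F.piecewise p.2 p.1 := by
    refine measurable_pi_lambda _ fun i => ?_
    by_cases hi : i ∈ F
    · simp only [Finset.piecewise_eq_of_mem _ _ _ hi]
      fun_prop
    · simp only [Finset.piecewise_eq_of_notMem _ _ _ hi]
      fun_prop
  have hmap : (Q.prod Q).map (fun p : (ι → X) × (ι → X) => F.piecewise p.2 p.1) = Q := by
    refine Measure.eq_infinitePi _ fun s t ht => ?_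
    rw [Measure.map_apply hpw (MeasurableSet.pi s.countable_toSet fun i _ => ht i)]
    -- A box constrains `p.1` only off `F` and `p.2` only on `F`, so its product measure splits into
    -- the two partial products.
    have hpre : (fun p : (ι → X) × (ι → X) => F.piecewise p.2 p.1) ⁻¹' Set.pi s t
        = (Set.pi ((s \ F : Finset ι) : Set ι) t) ×ˢ (Set.pi ((s ∩ F : Finset ι) : Set ι) t) := by
      ext p
      simp only [Set.mem_preimage, Set.mem_pi, Finset.mem_coe, Set.mem_prod, Finset.mem_sdiff,
        Finset.mem_inter]
      constructor
      · intro h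
        refine ⟨fun i hi => ?_, fun i hi => ?_⟩
        · simpa [hi.2] using h i hi.1
        · simpa [hi.2] using h i hi.1
      · rintro ⟨h1, h2⟩ i hi
        by_cases hF : i ∈ F
        · simpa [hF] using h2 i ⟨hi, hF⟩
        · simpa [hF] using h1 i ⟨hi, hF⟩
    rw [hpre, Measure.prod_prod, hQ, Measure.infinitePi_pi _ fun i _ => ht i,
      Measure.infinitePi_pi _ fun i _ => ht i, mul_comm, Finset.prod_inter_mul_prod_sdiff]
  conv_lhs => rw [← hmap]
  rw [lintegral_map hH hpw]
  exact lintegral_prod _ (hH.comp hpw).aemeasurable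

theorem lintegral_infinitePi_eq_update {ι X : Type*} [MeasurableSpace X] [DecidableEq ι]
    (μ : Measure X) [IsProbabilityMeasure μ] (i : ι) {H : (ι → X) → ℝ≥0∞} (hH : Measurable H) :
    ∫⁻ ω, H ω ∂Measure.infinitePi (fun _ : ι => μ) =
      ∫⁻ ω, ∫⁻ θ, H (Function.update ω i θ) ∂μ ∂Measure.infinitePi (fun _ : ι => μ) := by
  rw [lintegral_infinitePi_eq_piecewise μ {i} hH]
  refine lintegral_congr fun ω => ?_
  simp only [Finset.piecewise_singleton]
  conv_rhs => rw [← Measure.infinitePi_map_eval (fun _ : ι => μ) i]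
  exact (lintegral_map (f := fun θ => H (Function.update ω i θ)) (hH.comp (measurable_update ω))
    (measurable_pi_apply i)).symm

/-- The modulation given by phases at the vertices. -/
noncomputable def phases {V : Type*} (ω : V → Torus) : V → Disc := fun x => phaseDisc (ω x)

theorem measurable_phases {V : Type*} : Measurable (phases : (V → Torus) → V → Disc) :=
  measurable_pi_lambda _ fun x => measurable_phaseDisc.comp (measurable_pi_apply x)

end

/-! ### Herglotz functions and spectral averaging -/

section

variable {V : Type*} {G : SimpleGraph V} [DecidableEq V] [G.LocallyFinite]

theorem re_inner_sub_add {E : Type*} [NormedAddCommGroup E] [InnerProductSpace ℂ E] (x y : E) :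
    (inner ℂ (x - y) (x + y)).re = ‖x‖ ^ 2 - ‖y‖ ^ 2 := by
  have h := inner_re_symm (𝕜 := ℂ) x y
  have hx := inner_self_eq_norm_sq (𝕜 := ℂ) x
  have hy := inner_self_eq_norm_sq (𝕜 := ℂ) y
  simp only [RCLike.re_to_complex] at h hx hy
  rw [inner_sub_left, inner_add_right, inner_add_right, Complex.sub_re, Complex.add_re,
    Complex.add_re, hx, hy, h]
  ring

/-- The function `⟨φ, (z + T)(z - T)⁻¹ φ⟩` for the contraction `T = contr S a`. -/
noncomputable def herglotz (S : ScatteringFamily G) (a : V → Disc) (z : ℂ) (φ : EdgeSpace G) : ℂ :=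
  -inner ℂ φ (φ + (2 * z) • res S a z φ)

/-- With `ψ = res S a z φ`, the two arguments of the inner product are `(T - z) ψ` and `(T + z) ψ`,
where `T = contr S a`. The real part is therefore `‖z‖ ^ 2 * ‖ψ‖ ^ 2 - ‖T ψ‖ ^ 2`, and `T` is a
contraction. -/
theorem herglotz_re_pos (S : ScatteringFamily G) (a : V → Disc) {z : ℂ} (hz : 1 < ‖z‖)
    {φ : EdgeSpace G} (hφ : φ ≠ 0) : 0 < (herglotz S a z φ).re := by
  set ψ := res S a z φ with hψ
  have h1 : contr S a ψ = z • ψ + φ := contr_res S a hz φ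
  have h2 : φ = contr S a ψ - z • ψ := by rw [h1]; abel
  have h3 : φ + (2 * z) • ψ = contr S a ψ + z • ψ := by
    rw [h1, mul_smul, two_smul]; abel
  have hψ0 : ψ ≠ 0 := by
    intro h0
    apply hφ
    rw [h2, h0]
    simp
  have h4 : herglotz S a z φ = -inner ℂ (contr S a ψ - z • ψ) (contr S a ψ + z • ψ) := by
    rw [herglotz, ← hψ, h3, ← h2]
  rw [h4, Complex.neg_re, re_inner_sub_add, norm_smul]
  have h5 := norm_contr_apply_le S a ψ
  have h6 : ‖contr S a ψ‖ < ‖z‖ * ‖ψ‖ :=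
    h5.trans_lt (lt_mul_of_one_lt_left (norm_pos_iff.2 hψ0) hz)
  have := pow_lt_pow_left₀ h6 (norm_nonneg _) two_ne_zero
  linarith

/-- If the contraction does not reach the support of `φ`, the function is constant. -/
theorem herglotz_eq_norm_sq (S : ScatteringFamily G) (a : V → Disc) {z : ℂ} (hz : 1 < ‖z‖)
    {φ : EdgeSpace G} (hφ : ∀ e, φ e ≠ 0 → a e.fst = 0) : herglotz S a z φ = (‖φ‖ : ℂ) ^ 2 := by
  have h1 : inner ℂ φ (contr S a (res S a z φ)) = 0 := by
    rw [lp.inner_eq_tsum]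
    refine (tsum_congr fun e => ?_).trans tsum_zero
    by_cases h : φ e = 0
    · rw [h, inner_zero_left]
    · rw [contr_apply, hφ e h, Disc.coe_zero, zero_mul, inner_zero_right]
  rw [contr_res S a hz, inner_add_right, inner_smul_right] at h1
  rw [herglotz, inner_add_right, inner_smul_right, mul_assoc, eq_neg_of_add_eq_zero_left h1,
    inner_self_eq_norm_sq_to_K]
  simp only [Complex.coe_algebraMap]
  ring

/-- Selection of the edges which start at a vertex, as a modulation. -/
def indicatorDisc (u : V) : V → Disc := fun x => if x = u then ⟨1, by simp⟩ else 0

theorem contr_update (S : ScatteringFamily G) (a : V → Disc) (u : V) (w : Disc) :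
    contr S (Function.update a u w) =
      contr S (Function.update a u 0) + (w : ℂ) • contr S (indicatorDisc u) := by
  ext ψ e
  change ((Function.update a u w e.fst : Disc) : ℂ) * scatter S ψ e =
    ((Function.update a u 0 e.fst : Disc) : ℂ) * scatter S ψ e +
      (w : ℂ) * (((indicatorDisc u e.fst : Disc) : ℂ) * scatter S ψ e)
  by_cases h : e.fst = u
  · simp [h, indicatorDisc]
  · simp [h, indicatorDisc]

/-- As `contr` is affine in the variable at `u`, the Herglotz function is holomorphic in it on the
closed disc, and Kolmogorov's inequality applies with centre `a u = 0`. -/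
theorem lintegral_herglotz_update_le (S : ScatteringFamily G) (a : V → Disc) {z : ℂ} (hz : 1 < ‖z‖)
    {φ : EdgeSpace G} (hφ : φ ≠ 0) (u : V) {t : ℝ} (ht0 : 0 < t) (ht1 : t < 1) :
    ∫⁻ θ : Torus, ‖herglotz S (Function.update a u (phaseDisc θ)) z φ‖ₑ ^ t ≤
      ENNReal.ofReal (2 * Real.pi / Real.cos (t * (Real.pi / 2))) *
        ‖herglotz S (Function.update a u 0) z φ‖ₑ ^ t := by
  set L : ℂ → EdgeSpace G →L[ℂ] EdgeSpace G := fun w =>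
    contr S (Function.update a u 0) + w • contr S (indicatorDisc u) - z • 1 with hL
  set h : ℂ → ℂ := fun w => -inner ℂ φ (φ + (2 * z) • Ring.inverse (L w) φ) with hh
  have heq : ∀ w : Disc, h w = herglotz S (Function.update a u w) z φ := by
    intro w
    rw [herglotz, res, contr_update]
  have hd : ∀ w ∈ Metric.closedBall (0 : ℂ) 1, DifferentiableAt ℂ h w := by
    intro w hw
    have hu : IsUnit (L w) := by
      have := isUnit_contr_sub S (Function.update a u ⟨w, hw⟩) hz
      rwa [contr_update] at this
    have hL' : DifferentiableAt ℂ L w :=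
      ((differentiableAt_const _).add (differentiableAt_id.smul_const _)).sub_const _
    have hR : DifferentiableAt ℂ (fun w => Ring.inverse (L w)) w :=
      DifferentiableAt.comp w (differentiableAt_inverse hu) hL'
    have hRφ : DifferentiableAt ℂ (fun w => Ring.inverse (L w) φ) w :=
      hR.clm_apply (differentiableAt_const φ)
    have h1 : DifferentiableAt ℂ (fun w => φ + (2 * z) • Ring.inverse (L w) φ) w :=
      (hRφ.const_smul (2 * z)).const_add φ
    exact ((innerSL ℂ φ).differentiableAt.comp w h1).neg
  have hre : ∀ w ∈ Metric.closedBall (0 : ℂ) 1, 0 < (h w).re := by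
    intro w hw
    rw [heq ⟨w, hw⟩]
    exact herglotz_re_pos S _ hz hφ
  have key := lintegral_rpow_enorm_le_of_re_pos hd hre ht0 ht1
  have h0 : h 0 = herglotz S (Function.update a u 0) z φ := heq 0
  rw [h0] at key
  refine le_of_eq_of_le (lintegral_congr fun θ => ?_) key
  rw [← heq]
  rfl

theorem phases_update (ω : V → Torus) (u : V) (θ : Torus) :
    phases (Function.update ω u θ) = Function.update (phases ω) u (phaseDisc θ) := by
  funext x
  by_cases h : x = u
  · subst h; simp [phases]
  · simp [phases, h]

/-- The modulation `a` replaced by zero on `T`. -/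
def damp (T : Finset V) (a : V → Disc) : V → Disc := T.piecewise (fun _ => 0) a

theorem damp_of_mem {T : Finset V} {x : V} (hx : x ∈ T) (a : V → Disc) : damp T a x = 0 :=
  Finset.piecewise_eq_of_mem _ _ _ hx

theorem damp_insert (T : Finset V) (u : V) (a : V → Disc) :
    damp (insert u T) a = Function.update (damp T a) u 0 :=
  Finset.piecewise_insert _ _ _ _

theorem damp_update_of_notMem {T : Finset V} {u : V} (hu : u ∉ T) (a : V → Disc) (w : Disc) :
    damp T (Function.update a u w) = Function.update (damp T a) u w :=
  (Finset.update_piecewise_of_notMem (π := fun _ => Disc) T (fun _ => 0) a hu w).symm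

theorem measurable_damp (T : Finset V) : Measurable (damp T) := by
  refine measurable_pi_lambda _ fun i => ?_
  by_cases hi : i ∈ T
  · simp only [damp, Finset.piecewise_eq_of_mem _ _ _ hi]
    fun_prop
  · simp only [damp, Finset.piecewise_eq_of_notMem _ _ _ hi]
    fun_prop

theorem measurable_piecewise_left {ι X : Type*} [MeasurableSpace X] [DecidableEq ι]
    (F : Finset ι) (g : ι → X) : Measurable fun f : ι → X => F.piecewise f g := by
  refine measurable_pi_lambda _ fun i => ?_
  by_cases hi : i ∈ F
  · simp only [Finset.piecewise_eq_of_mem _ _ _ hi]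
    fun_prop
  · simp only [Finset.piecewise_eq_of_notMem _ _ _ hi]
    fun_prop

theorem piecewise_update_of_mem {ι X : Type*} [DecidableEq ι] {F : Finset ι} {i : ι} (hi : i ∈ F)
    (f g : ι → X) (x : X) :
    F.piecewise (Function.update f i x) g = Function.update (F.piecewise f g) i x := by
  funext j
  by_cases hj : j = i
  · subst hj; simp [hi]
  · by_cases hF : j ∈ F <;> simp [hj, hF]

section Averaging

variable (μ : Measure Torus) [IsProbabilityMeasure μ] {C : ℝ≥0∞} {t : ℝ}

/-- Spectral averaging over the phases at the vertices of `T ⊆ F`. -/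
theorem lintegral_herglotz_le (hμ : μ ≤ C • volume) (ht0 : 0 < t) (ht1 : t < 1)
    (S : ScatteringFamily G) {z : ℂ} (hz : 1 < ‖z‖) {φ : EdgeSpace G} (hφ : φ ≠ 0)
    (hm : Measurable fun a => herglotz S a z φ) (F T : Finset V) (hT : T ⊆ F) (ω : V → Torus) :
    ∫⁻ ζ, ‖herglotz S (phases (F.piecewise ζ ω)) z φ‖ₑ ^ t ∂Measure.infinitePi (fun _ : V => μ) ≤
      (C * ENNReal.ofReal (2 * Real.pi / Real.cos (t * (Real.pi / 2)))) ^ T.card *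
        ∫⁻ ζ, ‖herglotz S (damp T (phases (F.piecewise ζ ω))) z φ‖ₑ ^ t
          ∂Measure.infinitePi (fun _ : V => μ) := by
  set M := C * ENNReal.ofReal (2 * Real.pi / Real.cos (t * (Real.pi / 2))) with hM
  have hmT : ∀ T : Finset V, Measurable fun ζ =>
      ‖herglotz S (damp T (phases (F.piecewise ζ ω))) z φ‖ₑ ^ t := fun T =>
    (hm.comp ((measurable_damp T).comp
      (measurable_phases.comp (measurable_piecewise_left F ω)))).enorm.pow_const t
  induction T using Finset.induction_on with
  | empty => simp [damp]
  | insert u T hu ih =>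
    refine (ih ((Finset.subset_insert u T).trans hT)).trans ?_
    have huF : u ∈ F := hT (Finset.mem_insert_self u T)
    rw [Finset.card_insert_of_notMem hu, pow_succ, mul_assoc]
    gcongr
    -- The phase at `u` is isolated as an inner integral; it does enter the integrand, because `u ∈
    -- F` and `u ∉ T`.
    rw [lintegral_infinitePi_eq_update μ u (hmT T), ← lintegral_const_mul _ (hmT _)]
    refine lintegral_mono fun ζ => ?_
    have h1 : ∀ θ, damp T (phases (F.piecewise (Function.update ζ u θ) ω)) =
        Function.update (damp T (phases (F.piecewise ζ ω))) u (phaseDisc θ) := fun θ => by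
      rw [piecewise_update_of_mem huF, phases_update, damp_update_of_notMem hu]
    simp only [h1]
    rw [damp_insert, hM, mul_assoc]
    calc _ ≤ _ := lintegral_mono' hμ le_rfl
      _ = _ := lintegral_smul_measure _ _
      _ ≤ _ := by
        rw [smul_eq_mul]
        gcongr
        exact lintegral_herglotz_update_le S _ hz hφ u ht0 ht1

end Averaging

end

/-! ### Polarization and the a priori fractional moment bound -/

section

theorem sum_rpow_le_rpow_sum {ι : Type*} (T : Finset ι) (f : ι → ℝ≥0∞) {s : ℝ} (hs0 : 0 < s)
    (hs1 : s ≤ 1) : (∑ i ∈ T, f i) ^ s ≤ ∑ i ∈ T, f i ^ s :=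
  Finset.le_sum_of_subadditive (fun x : ℝ≥0∞ => x ^ s) (ENNReal.zero_rpow_of_pos hs0).le
    (fun _ _ => ENNReal.rpow_add_le_add_rpow _ _ hs0.le hs1) T f

variable {V : Type*} {G : SimpleGraph V} [DecidableEq V]

/-- The vectors `|e⟩ + iᵏ|e'⟩` of the polarization identity. -/
noncomputable def polVec (e e' : G.Dart) (k : ℕ) : EdgeSpace G := ket e + Complex.I ^ k • ket e'

theorem norm_polVec_le (e e' : G.Dart) (k : ℕ) : ‖polVec e e' k‖ ≤ 2 := by
  refine (norm_add_le _ _).trans ?_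
  rw [norm_smul, norm_ket, norm_ket, norm_pow, Complex.norm_I, one_pow]
  norm_num

theorem polVec_apply_eq_zero {e e' f : G.Dart} (h : f ≠ e) (h' : f ≠ e') (k : ℕ) :
    polVec e e' k f = 0 := by
  change (ket e : EdgeSpace G) f + Complex.I ^ k * (ket e' : EdgeSpace G) f = 0
  rw [ket_apply_ne h, ket_apply_ne h', mul_zero, add_zero]

variable [G.LocallyFinite]

/-- The definition of `herglotz` is solved for the diagonal element, and `‖z‖ > 1` bounds the factor
`2 * z` from below. -/
theorem two_mul_norm_inner_res_le (S : ScatteringFamily G) (a : V → Disc) {z : ℂ} (hz : 1 < ‖z‖)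
    (φ : EdgeSpace G) :
    2 * ‖(inner ℂ (res S a z φ) φ : ℂ)‖ ≤ ‖herglotz S a z φ‖ + ‖φ‖ ^ 2 := by
  have h1 : (2 * z) * inner ℂ φ (res S a z φ) = -herglotz S a z φ - inner ℂ φ φ := by
    rw [herglotz, inner_add_right, inner_smul_right]
    ring
  have h2 := norm_sub_le (-herglotz S a z φ) (inner ℂ φ φ)
  rw [← h1, norm_neg, norm_mul, norm_mul, inner_self_eq_norm_sq_to_K, norm_inner_symm] at h2
  simp only [Complex.norm_ofNat, Complex.coe_algebraMap, norm_pow, Complex.norm_real,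
    norm_norm] at h2
  refine le_trans ?_ h2
  gcongr
  linarith

theorem measurable_herglotz_polVec (S : ScatteringFamily G) {z : ℂ} (hz : 1 < ‖z‖)
    (e e' : G.Dart) (k : ℕ) : Measurable fun a => herglotz S a z (polVec e e' k) := by
  simp only [herglotz, polVec, map_add, map_smul, inner_add_right, inner_add_left,
    inner_smul_left, inner_smul_right, smul_add, inner_ket_left]
  have h := fun f f' => measurable_res S hz (G := G) f f'
  fun_prop (disch := assumption)

/-- Polarization reduces an off-diagonal element to four quadratic forms. Each contributes at most
`‖φ‖ ^ 2 / 2 ≤ 2` besides its Herglotz function, which after division by four leaves the constant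
`2`. -/
theorem norm_res_le_sum (S : ScatteringFamily G) (a : V → Disc) {z : ℂ} (hz : 1 < ‖z‖)
    (e e' : G.Dart) :
    ‖res S a z (ket e') e‖ ≤ 2 + ∑ k ∈ Finset.range 4, ‖herglotz S a z (polVec e e' k)‖ := by
  have hq : ∀ k, ‖(inner ℂ (res S a z (polVec e e' k)) (polVec e e' k) : ℂ)‖
      ≤ ‖herglotz S a z (polVec e e' k)‖ / 2 + 2 := fun k => by
    have h1 := two_mul_norm_inner_res_le S a hz (polVec e e' k)
    have h2 := pow_le_pow_left₀ (norm_nonneg _) (norm_polVec_le e e' k) 2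
    linarith
  have hp := inner_map_polarization (res S a z : EdgeSpace G →ₗ[ℂ] EdgeSpace G) (ket e) (ket e')
  have e0 : ket e + ket e' = polVec e e' 0 := by simp [polVec]
  have e1 : ket e + Complex.I • ket e' = polVec e e' 1 := by simp [polVec]
  have e2 : ket e - ket e' = polVec e e' 2 := by simp [polVec, sub_eq_add_neg]
  have e3 : ket e - Complex.I • ket e' = polVec e e' 3 := by
    simp [polVec, sub_eq_add_neg, Complex.I_pow_three]
  rw [e0, e1, e2, e3] at hp
  simp only [ContinuousLinearMap.coe_coe] at hp
  have h4 : ‖res S a z (ket e') e‖ = ‖(inner ℂ (res S a z (ket e')) (ket e) : ℂ)‖ := by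
    rw [← inner_ket_left e, norm_inner_symm]
  rw [h4, hp, norm_div, Complex.norm_ofNat]
  have h5 : ∀ A B C D : ℂ, ‖A - B + Complex.I * C - Complex.I * D‖ ≤ ‖A‖ + ‖B‖ + ‖C‖ + ‖D‖ := by
    intro A B C D
    refine (norm_sub_le _ _).trans (add_le_add ((norm_add_le _ _).trans (add_le_add
      (norm_sub_le _ _) ?_)) ?_)
    · rw [norm_mul, Complex.norm_I, one_mul]
    · rw [norm_mul, Complex.norm_I, one_mul]
  rw [div_le_iff₀ (by norm_num)]
  refine (h5 _ _ _ _).trans ?_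
  have := hq 0
  have := hq 1
  have := hq 2
  have := hq 3
  have := fun k => norm_nonneg (herglotz S a z (polVec e e' k))
  simp only [Finset.sum_range_succ, Finset.sum_range_zero]
  linarith [this 0, this 1, this 2, this 3]

section Averaging

variable (μ : Measure Torus) [IsProbabilityMeasure μ] {C : ℝ≥0∞} {t : ℝ}

/-- The bound for the conditional fractional moments of the resolvent. -/
noncomputable def momentBound (C : ℝ≥0∞) (t : ℝ) : ℝ≥0∞ :=
  2 ^ t + 4 * ((1 + C * ENNReal.ofReal (2 * Real.pi / Real.cos (t * (Real.pi / 2)))) ^ 2 * 4 ^ t)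

theorem momentBound_ne_top (hC : C ≠ ∞) : momentBound C t ≠ ∞ := by
  refine ENNReal.add_ne_top.2 ⟨by finiteness, ?_⟩
  finiteness

/-- The vector is supported on two edges, so killing at most two phases makes the Herglotz function
equal to `‖φ‖ ^ 2 ≤ 4`. The two starting vertices may coincide; the base `1 + …` lets the exponent
`2` cover both cases. -/
theorem lintegral_herglotz_polVec_le (hμ : μ ≤ C • volume) (ht0 : 0 < t) (ht1 : t < 1)
    (S : ScatteringFamily G) {z : ℂ} (hz : 1 < ‖z‖) (F : Finset V) {e e' : G.Dart}
    (he : e.fst ∈ F) (he' : e'.fst ∈ F) (ω : V → Torus) (k : ℕ) :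
    ∫⁻ ζ, ‖herglotz S (phases (F.piecewise ζ ω)) z (polVec e e' k)‖ₑ ^ t
        ∂Measure.infinitePi (fun _ : V => μ) ≤
      (1 + C * ENNReal.ofReal (2 * Real.pi / Real.cos (t * (Real.pi / 2)))) ^ 2 * 4 ^ t := by
  by_cases hφ : polVec e e' k = 0
  · simp [hφ, herglotz, ENNReal.zero_rpow_of_pos ht0]
  refine (lintegral_herglotz_le μ hμ ht0 ht1 S hz hφ (measurable_herglotz_polVec S hz e e' k) F
    {e.fst, e'.fst} (Finset.insert_subset he (Finset.singleton_subset_iff.2 he')) ω).trans ?_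
  refine mul_le_mul' ?_ ?_
  · exact (pow_le_pow_left' le_add_self _).trans
      (pow_le_pow_right₀ le_self_add Finset.card_le_two)
  · have h : ∀ ζ, herglotz S (damp {e.fst, e'.fst} (phases (F.piecewise ζ ω))) z (polVec e e' k)
        = (‖polVec e e' k‖ : ℂ) ^ 2 := fun ζ => by
      refine herglotz_eq_norm_sq S _ hz fun f hf => damp_of_mem ?_ _
      by_contra hn
      simp only [Finset.mem_insert, Finset.mem_singleton, not_or] at hn
      exact hf (polVec_apply_eq_zero (fun h => hn.1 (by rw [h])) (fun h => hn.2 (by rw [h])) k)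
    simp only [h, lintegral_const, measure_univ, mul_one]
    refine ENNReal.rpow_le_rpow ?_ ht0.le
    rw [← ofReal_norm, norm_pow, Complex.norm_real, norm_norm,
      ENNReal.ofReal_le_iff_le_toReal (by finiteness)]
    have := pow_le_pow_left₀ (norm_nonneg _) (norm_polVec_le e e' k) 2
    norm_num at this ⊢
    exact this

theorem lintegral_res_piecewise_le (hμ : μ ≤ C • volume) (ht0 : 0 < t) (ht1 : t < 1)
    (S : ScatteringFamily G) {z : ℂ} (hz : 1 < ‖z‖) (F : Finset V) {e e' : G.Dart}
    (he : e.fst ∈ F) (he' : e'.fst ∈ F) (ω : V → Torus) :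
    ∫⁻ ζ, ‖res S (phases (F.piecewise ζ ω)) z (ket e') e‖ₑ ^ t
        ∂Measure.infinitePi (fun _ : V => μ) ≤ momentBound C t := by
  have hpt : ∀ a, ‖res S a z (ket e') e‖ₑ ^ t ≤
      2 ^ t + ∑ k ∈ Finset.range 4, ‖herglotz S a z (polVec e e' k)‖ₑ ^ t := by
    intro a
    have h1 : ‖res S a z (ket e') e‖ₑ ≤
        2 + ∑ k ∈ Finset.range 4, ‖herglotz S a z (polVec e e' k)‖ₑ := by
      have h2 := ENNReal.ofReal_le_ofReal (norm_res_le_sum S a hz e e')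
      rw [ENNReal.ofReal_add (by norm_num) (Finset.sum_nonneg fun _ _ => norm_nonneg _),
        ENNReal.ofReal_sum_of_nonneg fun _ _ => norm_nonneg _, ENNReal.ofReal_ofNat] at h2
      simpa only [ofReal_norm] using h2
    refine (ENNReal.rpow_le_rpow h1 ht0.le).trans
      ((ENNReal.rpow_add_le_add_rpow _ _ ht0.le ht1.le).trans ?_)
    gcongr
    exact sum_rpow_le_rpow_sum _ _ ht0 ht1.le
  refine (lintegral_mono fun ζ => hpt _).trans ?_
  rw [lintegral_add_left measurable_const, lintegral_const, measure_univ, mul_one,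
    lintegral_finsetSum]
  · refine add_le_add le_rfl ?_
    refine (Finset.sum_le_sum fun k _ =>
      lintegral_herglotz_polVec_le μ hμ ht0 ht1 S hz F he he' ω k).trans ?_
    simp
  · intro k _
    exact ((measurable_herglotz_polVec S hz e e' k).comp
      (measurable_phases.comp (measurable_piecewise_left F ω))).enorm.pow_const t

end Averaging

end

/-! ### Small denominators and deterministic resolvent estimates -/

section

variable {V : Type*} {G : SimpleGraph V}

/-- The small denominator of an isolated edge. -/
noncomputable def denom (z : ℂ) (a : V → Disc) (e : G.Dart) : ℂ := z ^ 2 - a e.fst * a e.snd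

theorem denom_ne_zero {z : ℂ} (hz : 1 < ‖z‖) (a : V → Disc) (e : G.Dart) : denom z a e ≠ 0 := by
  intro h
  have h1 := congrArg norm (sub_eq_zero.1 h)
  rw [norm_pow, norm_mul] at h1
  nlinarith [mul_le_one₀ (a e.fst).norm_le_one (norm_nonneg _) (a e.snd).norm_le_one]

section Edges

variable [G.LocallyFinite]

variable (G) in
/-- The edges which start at `x`. -/
def outgoing (x : V) : Finset G.Dart :=
  Finset.univ.map ⟨G.dartOfNeighborSet x, fun _ _ h => Subtype.ext (congrArg (fun e => e.snd) h)⟩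

variable (G) in
/-- The edges which end at `x`. -/
def incoming (x : V) : Finset G.Dart :=
  (outgoing G x).map dartSymm.toEmbedding

theorem mem_outgoing {x : V} {e : G.Dart} : e ∈ outgoing G x ↔ e.fst = x := by
  simp only [outgoing, Finset.mem_map, Finset.mem_univ, true_and]
  constructor
  · rintro ⟨y, rfl⟩; rfl
  · rintro rfl; exact ⟨⟨e.snd, e.adj⟩, rfl⟩

theorem mem_incoming {x : V} {e : G.Dart} : e ∈ incoming G x ↔ e.snd = x := by
  simp only [incoming, Finset.mem_map, mem_outgoing]
  constructor
  · rintro ⟨f, rfl, rfl⟩; rfl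
  · rintro rfl; exact ⟨e.symm, rfl, e.symm_symm⟩

theorem card_outgoing (x : V) : (outgoing G x).card = G.degree x := by
  rw [outgoing, Finset.card_map, Finset.card_univ, SimpleGraph.card_neighborSet_eq_degree]

theorem card_incoming (x : V) : (incoming G x).card = G.degree x := by
  rw [incoming, Finset.card_map, card_outgoing]

theorem sum_incoming {M : Type*} [AddCommMonoid M] (x : V) (f : G.Dart → M) :
    ∑ e ∈ incoming G x, f e = ∑ y : G.neighborSet x, f (G.dartOfNeighborSet x y).symm := by
  rw [incoming, outgoing, Finset.sum_map, Finset.sum_map]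
  rfl

end Edges

variable [DecidableEq V]

/-- The two ends of an edge. -/
def ends (e : G.Dart) : Finset V := {e.fst, e.snd}

theorem sum_ends {M : Type*} [AddCommMonoid M] (e : G.Dart) (f : V → M) :
    ∑ x ∈ ends e, f x = f e.fst + f e.snd :=
  Finset.sum_pair e.adj.ne

variable [G.LocallyFinite]

theorem norm_sub_one_apply_le {S : ScatteringFamily G} {r : ℝ} (hr : 0 ≤ r)
    (hS : scatteringDist S (idFamily G) ≤ ENNReal.ofReal r) (x : V) (i j : G.neighborSet x) :
    ‖((S x : Matrix (G.neighborSet x) (G.neighborSet x) ℂ) - 1) i j‖ ≤ r := by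
  set A := (S x : Matrix (G.neighborSet x) (G.neighborSet x) ℂ) - 1 with hA
  have h1 : ENNReal.ofReal (hsNorm A) ≤ ENNReal.ofReal r := le_trans (le_iSup (fun x : V =>
    ENNReal.ofReal (hsNorm ((S x : Matrix (G.neighborSet x) (G.neighborSet x) ℂ) -
      (idFamily G x : Matrix (G.neighborSet x) (G.neighborSet x) ℂ)))) x) hS
  refine le_trans ?_ ((ENNReal.ofReal_le_ofReal_iff hr).1 h1)
  refine Real.le_sqrt_of_sq_le ?_
  calc ‖A i j‖ ^ 2 ≤ ∑ j, ‖A i j‖ ^ 2 :=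
        Finset.single_le_sum (f := fun j => ‖A i j‖ ^ 2) (fun _ _ => by positivity)
          (Finset.mem_univ j)
    _ ≤ _ := Finset.single_le_sum (f := fun i => ∑ j, ‖A i j‖ ^ 2)
          (fun _ _ => Finset.sum_nonneg fun _ _ => by positivity) (Finset.mem_univ i)

theorem norm_scatter_sub_le {S : ScatteringFamily G} {r : ℝ} (hr : 0 ≤ r)
    (hS : scatteringDist S (idFamily G) ≤ ENNReal.ofReal r) (ψ : G.Dart → ℂ) (e : G.Dart) :
    ‖scatter S ψ e - ψ e.symm‖ ≤ r * ∑ f ∈ incoming G e.fst, ‖ψ f‖ := by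
  have h : scatter S ψ e - ψ e.symm = ∑ y : G.neighborSet e.fst,
      ((S e.fst : Matrix (G.neighborSet e.fst) (G.neighborSet e.fst) ℂ) - 1) ⟨e.snd, e.adj⟩ y *
        ψ (G.dartOfNeighborSet e.fst y).symm := by
    simp only [Matrix.sub_apply, sub_mul, Finset.sum_sub_distrib, Matrix.one_apply, ite_mul,
      one_mul, zero_mul, Finset.sum_ite_eq, Finset.mem_univ, if_true]
    rfl
  rw [h, sum_incoming, Finset.mul_sum]
  refine (norm_sum_le _ _).trans (Finset.sum_le_sum fun y _ => ?_)
  rw [norm_mul]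
  exact mul_le_mul_of_nonneg_right (norm_sub_one_apply_le hr hS _ _ _) (norm_nonneg _)

theorem norm_scatter_le (S : ScatteringFamily G) (ψ : G.Dart → ℂ) (e : G.Dart) :
    ‖scatter S ψ e‖ ≤ ∑ f ∈ incoming G e.fst, ‖ψ f‖ := by
  rw [sum_incoming]
  refine (norm_sum_le _ _).trans (Finset.sum_le_sum fun y _ => ?_)
  rw [norm_mul]
  exact mul_le_of_le_one_left (norm_nonneg _) (entry_norm_bound_of_unitary (S e.fst).2 _ _)

/-- At `e` and at `e.symm` the resolvent equation has no source term. Up to errors `k`, `k'` of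
order `r`, these rows couple only `ψ e` and `ψ e.symm`; eliminating the latter gives `denom z a e *
ψ e` as a combination of the errors. -/
theorem norm_res_le_denom {S : ScatteringFamily G} {r : ℝ} (hr : 0 ≤ r)
    (hS : scatteringDist S (idFamily G) ≤ ENNReal.ofReal r) (a : V → Disc) {z : ℂ} (hz : 1 < ‖z‖)
    (hz2 : ‖z‖ ≤ 2) {e e' : G.Dart} (h1 : e ≠ e') (h2 : e.symm ≠ e') :
    ‖res S a z (ket e') e‖ ≤ 2 * r * ‖(denom z a e)⁻¹‖ *
      ∑ x ∈ ends e, ∑ f ∈ incoming G x, ‖res S a z (ket e') f‖ := by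
  set ψ := res S a z (ket e') with hψ
  have hrow : ∀ f, f ≠ e' → (a f.fst : ℂ) * scatter S ψ f = z * ψ f := by
    intro f hf
    have h := congrArg (fun χ : EdgeSpace G => χ f) (contr_res S a hz (ket e'))
    change (a f.fst : ℂ) * scatter S ψ f = z * ψ f + (ket e' : EdgeSpace G) f at h
    rwa [ket_apply_ne hf, add_zero] at h
  have r1 := hrow e h1
  have r2 : (a e.snd : ℂ) * scatter S ψ e.symm = z * ψ e.symm := hrow e.symm h2
  have b1 := norm_scatter_sub_le hr hS ψ e
  have b2 : ‖scatter S ψ e.symm - ψ e‖ ≤ r * ∑ f ∈ incoming G e.snd, ‖ψ f‖ :=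
    norm_scatter_sub_le hr hS ψ e.symm
  set k := scatter S ψ e - ψ e.symm
  set k' := scatter S ψ e.symm - ψ e
  have hk : scatter S ψ e = ψ e.symm + k := by simp [k]
  have hk' : scatter S ψ e.symm = ψ e + k' := by simp [k']
  rw [hk] at r1
  rw [hk'] at r2
  have key : ψ e = (denom z a e)⁻¹ * ((a e.fst : ℂ) * (a e.snd : ℂ) * k' + a e.fst * z * k) := by
    rw [eq_inv_mul_iff_mul_eq₀ (denom_ne_zero hz a e), denom]
    linear_combination (-z) * r1 - (a e.fst : ℂ) * r2
  have n1 := (a e.fst).norm_le_one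
  have n2 := (a e.snd).norm_le_one
  have bound : ‖(a e.fst : ℂ) * (a e.snd : ℂ) * k' + a e.fst * z * k‖ ≤ 2 * ‖k'‖ + 2 * ‖k‖ := by
    refine (norm_add_le _ _).trans (add_le_add ?_ ?_)
    · rw [norm_mul, norm_mul]
      gcongr
      exact (mul_le_one₀ n1 (norm_nonneg _) n2).trans one_le_two
    · rw [norm_mul, norm_mul]
      gcongr
      exact (mul_le_of_le_one_left (norm_nonneg _) n1).trans hz2
  rw [key, norm_mul, sum_ends]
  refine (mul_le_mul_of_nonneg_left (bound.trans ?_) (norm_nonneg _)).trans_eq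
    (mul_left_comm _ (2 * r) _ |>.trans (mul_assoc _ _ _).symm)
  linarith

/-- Changing the modulation on a finite set of vertices changes the resolvent by a finite sum. -/
theorem norm_res_le_of_eqOn (S : ScatteringFamily G) {a b : V → Disc} {F : Finset V}
    (hab : ∀ x ∉ F, a x = b x) {z : ℂ} (hz : 1 < ‖z‖) (e e' : G.Dart) :
    ‖res S a z (ket e') e‖ ≤ ‖res S b z (ket e') e‖ + ∑ v ∈ F, ∑ h ∈ outgoing G v,
      ∑ f ∈ incoming G v, 2 * (‖res S a z (ket h) e‖ * ‖res S b z (ket e') f‖) := by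
  set χ := res S b z (ket e') with hχ
  -- The two modulations differ only on `F`, so the difference of the contractions is a finite
  -- combination of edges leaving `F`, with coefficients containing `|a v - b v| ≤ 2`.
  have hdiff : contr S a χ - contr S b χ =
      ∑ v ∈ F, ∑ h ∈ outgoing G v, (((a v : ℂ) - b v) * scatter S χ h) • ket h := by
    ext e
    change (a e.fst : ℂ) * scatter S χ e - (b e.fst : ℂ) * scatter S χ e = _
    simp only [lp.coeFn_sum, Finset.sum_apply, lp.coeFn_smul, Pi.smul_apply, smul_eq_mul]
    have hin : ∀ v, ∑ h ∈ outgoing G v, ((a v : ℂ) - b v) * scatter S χ h * (ket h : EdgeSpace G) e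
        = if v = e.fst then ((a v : ℂ) - b v) * scatter S χ e else 0 := by
      intro v
      split_ifs with hv
      · rw [Finset.sum_eq_single_of_mem e (mem_outgoing.2 hv.symm), ket_apply_self, mul_one]
        intro h _ hne
        rw [ket_apply_ne hne.symm, mul_zero]
      · refine Finset.sum_eq_zero fun h hh => ?_
        rw [ket_apply_ne, mul_zero]
        rintro rfl
        exact hv (mem_outgoing.1 hh).symm
    simp only [hin, Finset.sum_ite_eq']
    split_ifs with hF
    · ring
    · rw [hab _ hF, sub_self]
  have h1 := congrArg (fun ξ : EdgeSpace G => ξ e) (res_sub_res S a b hz (ket e'))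
  rw [← hχ, hdiff, map_sum] at h1
  simp only [map_sum, map_smul] at h1
  change res S a z (ket e') e = χ e - (∑ v ∈ F, ∑ h ∈ outgoing G v,
    (((a v : ℂ) - b v) * scatter S χ h) • res S a z (ket h) : EdgeSpace G) e at h1
  simp only [lp.coeFn_sum, Finset.sum_apply, lp.coeFn_smul, Pi.smul_apply, smul_eq_mul] at h1
  rw [h1]
  refine (norm_sub_le _ _).trans (add_le_add le_rfl ?_)
  refine (norm_sum_le _ _).trans (Finset.sum_le_sum fun v _ => ?_)
  refine (norm_sum_le _ _).trans (Finset.sum_le_sum fun h hh => ?_)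
  rw [← Finset.mul_sum, ← Finset.mul_sum, norm_mul, norm_mul, mul_comm ‖res S a z (ket h) e‖,
    ← mul_assoc]
  have hs := norm_scatter_le S χ h
  rw [mem_outgoing.1 hh] at hs
  gcongr
  refine (norm_sub_le _ _).trans ?_
  linarith [(a v).norm_le_one, (b v).norm_le_one]

end

/-! ### Averaged denominators and the geometry of one step -/

section

variable {V : Type*} {G : SimpleGraph V}

theorem measurable_denom_inv (z : ℂ) (e : G.Dart) :
    Measurable fun a : V → Disc => (denom z a e)⁻¹ := by
  unfold denom
  have h := fun x : V => measurable_subtype_coe.comp (measurable_pi_apply (X := fun _ : V => Disc) x)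
  exact (((h e.fst).mul (h e.snd)).const_sub _).inv

variable [DecidableEq V]

section Averaging

variable (μ : Measure Torus) [IsProbabilityMeasure μ] {C : ℝ≥0∞} {t s : ℝ}

/-- As a function of the phase `w` at `e.fst`, the denominator is `z ^ 2 * u w` with `re (u w) > 0`.
Hence `u⁻¹` also has positive real part, with value `1` at the centre, and the factor `z ^ (-2)`
only helps. -/
theorem lintegral_denom_update_le (a : V → Disc) {z : ℂ} (hz : 1 < ‖z‖) (e : G.Dart)
    (ht0 : 0 < t) (ht1 : t < 1) :
    ∫⁻ θ : Torus, ‖(denom z (Function.update a e.fst (phaseDisc θ)) e)⁻¹‖ₑ ^ t ≤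
      ENNReal.ofReal (2 * Real.pi / Real.cos (t * (Real.pi / 2))) := by
  set u : ℂ → ℂ := fun w => 1 - w * (a e.snd : ℂ) / z ^ 2 with hu
  have hz2 : 1 < ‖z ^ 2‖ := by
    rw [norm_pow]; nlinarith
  have hz0 : z ^ 2 ≠ 0 := norm_pos_iff.1 (zero_lt_one.trans hz2)
  have hre : ∀ w ∈ Metric.closedBall (0 : ℂ) 1, 0 < (u w).re := by
    intro w hw
    have h1 : ‖w * (a e.snd : ℂ) / z ^ 2‖ < 1 := by
      rw [norm_div, norm_mul, div_lt_one (by linarith)]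
      exact (mul_le_one₀ (mem_closedBall_zero_iff.1 hw) (norm_nonneg _)
        (a e.snd).norm_le_one).trans_lt hz2
    have h2 := (Complex.re_le_norm (w * (a e.snd : ℂ) / z ^ 2)).trans_lt h1
    rw [hu]
    simp only [Complex.sub_re, Complex.one_re]
    linarith
  have hne : ∀ w ∈ Metric.closedBall (0 : ℂ) 1, u w ≠ 0 := fun w hw h => by
    simpa [h] using hre w hw
  have key := lintegral_rpow_enorm_le_of_re_pos (h := fun w => (u w)⁻¹)
    (fun w hw => DifferentiableAt.inv (by fun_prop) (hne w hw))
    (fun w hw => by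
      rw [Complex.inv_re]
      exact div_pos (hre w hw) (Complex.normSq_pos.2 (hne w hw))) ht0 ht1
  have h0 : (u 0)⁻¹ = 1 := by simp [hu]
  rw [h0, enorm_one, ENNReal.one_rpow, mul_one] at key
  refine (lintegral_mono fun θ => ENNReal.rpow_le_rpow ?_ ht0.le).trans key
  have h1 : denom z (Function.update a e.fst (phaseDisc θ)) e = z ^ 2 * u (phase θ) := by
    rw [denom, Function.update_self, Function.update_of_ne e.adj.ne']
    change z ^ 2 - (phase θ : ℂ) * (a e.snd : ℂ) = z ^ 2 * (1 - phase θ * (a e.snd : ℂ) / z ^ 2)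
    rw [mul_sub, mul_one, mul_div_cancel₀ _ hz0]
  rw [h1, mul_inv, enorm_mul]
  refine mul_le_of_le_one_left zero_le ?_
  rw [← ofReal_norm, norm_inv, ENNReal.ofReal_le_one]
  exact inv_le_one_of_one_le₀ hz2.le

theorem lintegral_denom_piecewise_le (hμ : μ ≤ C • volume) (ht0 : 0 < t) (ht1 : t < 1)
    {z : ℂ} (hz : 1 < ‖z‖) (F : Finset V) {e : G.Dart} (he : e.fst ∈ F) (ω : V → Torus) :
    ∫⁻ ζ, ‖(denom z (phases (F.piecewise ζ ω)) e)⁻¹‖ₑ ^ t ∂Measure.infinitePi (fun _ : V => μ)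
      ≤ momentBound C t := by
  have hm : Measurable fun ζ => ‖(denom z (phases (F.piecewise ζ ω)) e)⁻¹‖ₑ ^ t :=
    ((measurable_denom_inv z e).comp
      (measurable_phases.comp (measurable_piecewise_left F ω))).enorm.pow_const t
  rw [lintegral_infinitePi_eq_update μ e.fst hm]
  set K := C * ENNReal.ofReal (2 * Real.pi / Real.cos (t * (Real.pi / 2))) with hK
  have h1 : ∀ ζ, ∫⁻ θ, ‖(denom z (phases (F.piecewise (Function.update ζ e.fst θ) ω)) e)⁻¹‖ₑ ^ t ∂μ
      ≤ K := by
    intro ζ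
    simp only [piecewise_update_of_mem he, phases_update]
    calc _ ≤ _ := lintegral_mono' hμ le_rfl
      _ = _ := lintegral_smul_measure _ _
      _ ≤ _ := by
        rw [smul_eq_mul, hK]
        gcongr
        exact lintegral_denom_update_le _ hz e ht0 ht1
  refine (lintegral_mono h1).trans ?_
  rw [lintegral_const, measure_univ, mul_one, momentBound, ← hK]
  calc K ≤ 1 + K := le_add_self
    _ ≤ (1 + K) ^ 2 := le_self_pow le_self_add two_ne_zero
    _ = 1 * ((1 + K) ^ 2 * 1) := by ring
    _ ≤ 4 * ((1 + K) ^ 2 * 4 ^ t) := by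
      gcongr
      · norm_num
      · exact ENNReal.one_le_rpow (by norm_num) ht0
    _ ≤ _ := le_add_self

variable [G.LocallyFinite]

theorem measurable_enorm_res_phases (S : ScatteringFamily G) {z : ℂ} (hz : 1 < ‖z‖) (e e' : G.Dart)
    (t : ℝ) : Measurable fun ω => ‖res S (phases ω) z (ket e') e‖ₑ ^ t :=
  ((measurable_res S hz e e').comp measurable_phases).enorm.pow_const t

/-- Both factors depend on the same resampled phases, so they are separated by Cauchy–Schwarz; this
doubles the exponent and is the source of the condition `s < 1 / 2`. -/
theorem lintegral_denom_mul_res_le (hμ : μ ≤ C • volume) (hs0 : 0 < s) (hs1 : s < 1 / 2)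
    (S : ScatteringFamily G) {z : ℂ} (hz : 1 < ‖z‖) (F : Finset V) {e f h : G.Dart}
    (he : e.fst ∈ F) (hf : f.fst ∈ F) (hh : h.fst ∈ F) (ω : V → Torus) :
    ∫⁻ ζ, ‖(denom z (phases (F.piecewise ζ ω)) e)⁻¹‖ₑ ^ s *
        ‖res S (phases (F.piecewise ζ ω)) z (ket h) f‖ₑ ^ s ∂Measure.infinitePi (fun _ : V => μ)
      ≤ momentBound C (2 * s) := by
  have hmp := measurable_phases.comp (measurable_piecewise_left F ω)
  have h2 : (2 : ℝ).HolderConjugate 2 := Real.HolderConjugate.two_two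
  refine (ENNReal.lintegral_mul_le_Lp_mul_Lq _ h2
    (((measurable_denom_inv z e).comp hmp).enorm.pow_const s).aemeasurable
    (((measurable_res S hz f h).comp hmp).enorm.pow_const s).aemeasurable).trans ?_
  simp only [Function.comp_apply, ← ENNReal.rpow_mul, mul_comm s 2]
  have b1 := lintegral_denom_piecewise_le μ hμ (t := 2 * s) (by linarith) (by linarith) hz F he ω
  have b2 := lintegral_res_piecewise_le μ hμ (t := 2 * s) (by linarith) (by linarith) S hz F hf hh ω
  refine (mul_le_mul' (ENNReal.rpow_le_rpow b1 (by norm_num))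
    (ENNReal.rpow_le_rpow b2 (by norm_num))).trans_eq ?_
  rw [← ENNReal.rpow_add_of_nonneg _ _ (by norm_num) (by norm_num)]
  norm_num

/-- The fractional moment of a matrix element of the resolvent. -/
noncomputable def moment (S : ScatteringFamily G) (z : ℂ) (s : ℝ) (e' e : G.Dart) : ℝ≥0∞ :=
  ∫⁻ ω, ‖res S (phases ω) z (ket e') e‖ₑ ^ s ∂Measure.infinitePi (fun _ : V => μ)

theorem moment_le (hμ : μ ≤ C • volume) (hs0 : 0 < s) (hs1 : s < 1) (S : ScatteringFamily G)
    {z : ℂ} (hz : 1 < ‖z‖) (e' e : G.Dart) : moment μ S z s e' e ≤ momentBound C s := by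
  rw [moment, lintegral_infinitePi_eq_piecewise μ {e.fst, e'.fst}
    (measurable_enorm_res_phases S hz e e' s)]
  refine (lintegral_mono fun ω => lintegral_res_piecewise_le μ hμ hs0 hs1 S hz _
    (by simp) (by simp) ω).trans ?_
  rw [lintegral_const, measure_univ, mul_one]

/-- The ends of an edge and their neighbours. -/
def surroundings (e : G.Dart) : Finset V := (ends e).biUnion fun x => insert x (G.neighborFinset x)

theorem fst_mem_surroundings (e : G.Dart) : e.fst ∈ surroundings e :=
  Finset.mem_biUnion.2 ⟨e.fst, by simp [ends], Finset.mem_insert_self _ _⟩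

theorem ends_subset_surroundings (e : G.Dart) : ends e ⊆ surroundings e := fun x hx =>
  Finset.mem_biUnion.2 ⟨x, hx, Finset.mem_insert_self _ _⟩

/-- This is why the neighbours are resampled too: the a priori bound for an element at `f` needs the
phase at the start of `f` to be averaged. -/
theorem fst_mem_surroundings_of_incoming {e f : G.Dart} {x : V} (hx : x ∈ ends e)
    (hf : f ∈ incoming G x) : f.fst ∈ surroundings e := by
  refine Finset.mem_biUnion.2 ⟨x, hx, Finset.mem_insert_of_mem ?_⟩
  rw [SimpleGraph.mem_neighborFinset, ← mem_incoming.1 hf]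
  exact f.adj.symm

theorem card_surroundings_le {d : ℕ} (hd : ∀ x : V, G.degree x ≤ d) (e : G.Dart) :
    (surroundings e).card ≤ 2 * (d + 1) := by
  refine (Finset.card_biUnion_le_card_mul _ _ (d + 1) fun x _ => ?_).trans
    (Nat.mul_le_mul_right _ Finset.card_le_two)
  refine (Finset.card_insert_le _ _).trans (Nat.succ_le_succ ?_)
  rw [SimpleGraph.card_neighborFinset_eq_degree]
  exact hd x

theorem edist_snd_le_two {e : G.Dart} {v : V} (hv : v ∈ surroundings e) : G.edist e.snd v ≤ 2 := by
  obtain ⟨x, hx, hv⟩ := Finset.mem_biUnion.1 hv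
  have h1 : G.edist e.snd x ≤ 1 := by
    simp only [ends, Finset.mem_insert, Finset.mem_singleton] at hx
    rcases hx with rfl | rfl
    · exact (SimpleGraph.edist_eq_one_iff_adj.2 e.adj.symm).le
    · simp
  have h2 : G.edist x v ≤ 1 := by
    rcases Finset.mem_insert.1 hv with rfl | h
    · simp
    · exact (SimpleGraph.edist_eq_one_iff_adj.2 ((G.mem_neighborFinset x v).1 h)).le
  calc G.edist e.snd v ≤ G.edist e.snd x + G.edist x v := SimpleGraph.edist_triangle
    _ ≤ 1 + 1 := add_le_add h1 h2
    _ = 2 := one_add_one_eq_two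

end Averaging

end

/-! ### One step of the decay estimate and its iteration -/

section

variable {V : Type*} {G : SimpleGraph V} [DecidableEq V] [G.LocallyFinite]

theorem rpow_enorm_res_le_denom {S : ScatteringFamily G} {r s : ℝ} (hr : 0 ≤ r)
    (hS : scatteringDist S (idFamily G) ≤ ENNReal.ofReal r) (a : V → Disc) {z : ℂ} (hz : 1 < ‖z‖)
    (hz2 : ‖z‖ ≤ 2) (hs0 : 0 < s) (hs1 : s ≤ 1) {e e' : G.Dart} (h1 : e ≠ e') (h2 : e.symm ≠ e') :
    ‖res S a z (ket e') e‖ₑ ^ s ≤ ENNReal.ofReal (2 * r) ^ s * ∑ x ∈ ends e, ∑ f ∈ incoming G x,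
      ‖(denom z a e)⁻¹‖ₑ ^ s * ‖res S a z (ket e') f‖ₑ ^ s := by
  have h : ‖res S a z (ket e') e‖ₑ ≤ ENNReal.ofReal (2 * r) * ‖(denom z a e)⁻¹‖ₑ *
      ∑ x ∈ ends e, ∑ f ∈ incoming G x, ‖res S a z (ket e') f‖ₑ := by
    have h0 := norm_res_le_denom hr hS a hz hz2 h1 h2
    rw [← Real.coe_toNNReal (2 * r) (by positivity)] at h0
    simp only [← coe_nnnorm] at h0
    simp only [enorm_eq_nnnorm, ENNReal.ofReal]
    exact_mod_cast h0
  refine (ENNReal.rpow_le_rpow h hs0.le).trans ?_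
  rw [ENNReal.mul_rpow_of_nonneg _ _ hs0.le, ENNReal.mul_rpow_of_nonneg _ _ hs0.le, mul_assoc]
  simp only [← Finset.mul_sum]
  gcongr
  exact (sum_rpow_le_rpow_sum _ _ hs0 hs1).trans
    (Finset.sum_le_sum fun x _ => sum_rpow_le_rpow_sum _ _ hs0 hs1)

theorem rpow_enorm_res_le_of_eqOn (S : ScatteringFamily G) {a b : V → Disc} {F : Finset V}
    (hab : ∀ x ∉ F, a x = b x) {z : ℂ} (hz : 1 < ‖z‖) {s : ℝ} (hs0 : 0 < s) (hs1 : s ≤ 1)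
    (e e' : G.Dart) :
    ‖res S a z (ket e') e‖ₑ ^ s ≤ ‖res S b z (ket e') e‖ₑ ^ s + ∑ v ∈ F, ∑ h ∈ outgoing G v,
      ∑ f ∈ incoming G v, 2 ^ s * (‖res S a z (ket h) e‖ₑ ^ s * ‖res S b z (ket e') f‖ₑ ^ s) := by
  have h : ‖res S a z (ket e') e‖ₑ ≤ ‖res S b z (ket e') e‖ₑ + ∑ v ∈ F, ∑ h ∈ outgoing G v,
      ∑ f ∈ incoming G v, 2 * (‖res S a z (ket h) e‖ₑ * ‖res S b z (ket e') f‖ₑ) := by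
    have h0 := norm_res_le_of_eqOn S hab hz e e'
    simp only [← coe_nnnorm] at h0
    simp only [enorm_eq_nnnorm]
    exact_mod_cast h0
  refine (ENNReal.rpow_le_rpow h hs0.le).trans
    ((ENNReal.rpow_add_le_add_rpow _ _ hs0.le hs1).trans (add_le_add le_rfl ?_))
  refine (sum_rpow_le_rpow_sum _ _ hs0 hs1).trans (Finset.sum_le_sum fun v _ => ?_)
  refine (sum_rpow_le_rpow_sum _ _ hs0 hs1).trans (Finset.sum_le_sum fun h _ => ?_)
  refine (sum_rpow_le_rpow_sum _ _ hs0 hs1).trans (Finset.sum_le_sum fun f _ => ?_)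
  rw [ENNReal.mul_rpow_of_nonneg _ _ hs0.le, ENNReal.mul_rpow_of_nonneg _ _ hs0.le]

variable (μ : Measure Torus) [IsProbabilityMeasure μ] {C : ℝ≥0∞} {s : ℝ}

/-- The resolvent identity moves the dependence on `e'` into resolvents at the old phases `ω`, which
are constant for the integration over `ζ`. What remains under the integral is a denominator, alone
or times an element between edges that start in the resampled region. -/
theorem lintegral_denom_mul_res_piecewise_le (hμ : μ ≤ C • volume) (hs0 : 0 < s) (hs1 : s < 1 / 2)
    (S : ScatteringFamily G) {z : ℂ} (hz : 1 < ‖z‖) {e e' f : G.Dart} {x : V} (hx : x ∈ ends e)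
    (hf : f ∈ incoming G x) (ω : V → Torus) :
    ∫⁻ ζ, ‖(denom z (phases ((surroundings e).piecewise ζ ω)) e)⁻¹‖ₑ ^ s *
        ‖res S (phases ((surroundings e).piecewise ζ ω)) z (ket e') f‖ₑ ^ s
          ∂Measure.infinitePi (fun _ : V => μ)
      ≤ momentBound C s * ‖res S (phases ω) z (ket e') f‖ₑ ^ s +
        ∑ v ∈ surroundings e, ∑ _h ∈ outgoing G v, ∑ k ∈ incoming G v,
          2 ^ s * (momentBound C (2 * s) * ‖res S (phases ω) z (ket e') k‖ₑ ^ s) := by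
  set F := surroundings e with hF
  have hmp := measurable_phases.comp (measurable_piecewise_left F ω)
  have hmd : Measurable fun ζ => ‖(denom z (phases (F.piecewise ζ ω)) e)⁻¹‖ₑ ^ s :=
    ((measurable_denom_inv z e).comp hmp).enorm.pow_const s
  have hmr : ∀ h, Measurable fun ζ => ‖res S (phases (F.piecewise ζ ω)) z (ket h) f‖ₑ ^ s :=
    fun h => ((measurable_res S hz f h).comp hmp).enorm.pow_const s
  have hpt : ∀ ζ, ‖(denom z (phases (F.piecewise ζ ω)) e)⁻¹‖ₑ ^ s *
        ‖res S (phases (F.piecewise ζ ω)) z (ket e') f‖ₑ ^ s ≤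
      ‖(denom z (phases (F.piecewise ζ ω)) e)⁻¹‖ₑ ^ s * ‖res S (phases ω) z (ket e') f‖ₑ ^ s +
      ∑ v ∈ F, ∑ h ∈ outgoing G v, ∑ k ∈ incoming G v,
        2 ^ s * ((‖(denom z (phases (F.piecewise ζ ω)) e)⁻¹‖ₑ ^ s *
          ‖res S (phases (F.piecewise ζ ω)) z (ket h) f‖ₑ ^ s) *
            ‖res S (phases ω) z (ket e') k‖ₑ ^ s) := by
    intro ζ
    refine (mul_le_mul_right (rpow_enorm_res_le_of_eqOn S (a := phases (F.piecewise ζ ω))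
      (b := phases ω) (F := F) (fun x hx => ?_) hz hs0 (by linarith) f e') _).trans_eq ?_
    · rw [phases, phases, Finset.piecewise_eq_of_notMem _ _ _ hx]
    · simp only [mul_add, Finset.mul_sum]
      congr! 4
      ring
  refine (lintegral_mono hpt).trans ?_
  rw [lintegral_add_left (hmd.mul_const _), lintegral_mul_const _ hmd]
  refine add_le_add ?_ ?_
  · gcongr
    exact lintegral_denom_piecewise_le μ hμ hs0 (by linarith) hz F (fst_mem_surroundings e) ω
  · have hm1 : ∀ h, Measurable fun ζ => ‖(denom z (phases (F.piecewise ζ ω)) e)⁻¹‖ₑ ^ s *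
        ‖res S (phases (F.piecewise ζ ω)) z (ket h) f‖ₑ ^ s := fun h => hmd.mul (hmr h)
    have hm : ∀ h k, Measurable fun ζ => 2 ^ s * ((‖(denom z (phases (F.piecewise ζ ω)) e)⁻¹‖ₑ ^ s *
          ‖res S (phases (F.piecewise ζ ω)) z (ket h) f‖ₑ ^ s) *
            ‖res S (phases ω) z (ket e') k‖ₑ ^ s) := fun h k =>
      ((hm1 h).mul_const _).const_mul _
    rw [lintegral_finsetSum _ fun v _ => Finset.measurable_sum _ fun h _ =>
      Finset.measurable_sum _ fun k _ => hm h k]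
    refine Finset.sum_le_sum fun v hv => ?_
    rw [lintegral_finsetSum _ fun h _ => Finset.measurable_sum _ fun k _ => hm h k]
    refine Finset.sum_le_sum fun h hh => ?_
    rw [lintegral_finsetSum _ fun k _ => hm h k]
    refine Finset.sum_le_sum fun k _ => ?_
    rw [lintegral_const_mul _ ((hm1 h).mul_const _), lintegral_mul_const _ (hm1 h)]
    gcongr
    exact lintegral_denom_mul_res_le μ hμ hs0 hs1 S hz F (fst_mem_surroundings e)
      (fst_mem_surroundings_of_incoming hx hf) (by rwa [mem_outgoing.1 hh]) ω

/-- Resampling leaves the law unchanged: the inner average over the new phases produces constants,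
and the outer average over `ω` turns the remaining elements back into moments with the same source
`e'`. -/
theorem moment_le_sum (hμ : μ ≤ C • volume) (hs0 : 0 < s) (hs1 : s < 1 / 2)
    {S : ScatteringFamily G} {r : ℝ} (hr : 0 ≤ r)
    (hS : scatteringDist S (idFamily G) ≤ ENNReal.ofReal r) {z : ℂ} (hz : 1 < ‖z‖)
    (hz2 : ‖z‖ ≤ 2) {e e' : G.Dart} (h1 : e ≠ e') (h2 : e.symm ≠ e') :
    moment μ S z s e' e ≤ ENNReal.ofReal (2 * r) ^ s * ∑ x ∈ ends e, ∑ f ∈ incoming G x,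
      (momentBound C s * moment μ S z s e' f +
        ∑ v ∈ surroundings e, ∑ _h ∈ outgoing G v, ∑ k ∈ incoming G v,
          2 ^ s * (momentBound C (2 * s) * moment μ S z s e' k)) := by
  set F := surroundings e with hF
  have hmω := fun f => measurable_enorm_res_phases S hz f e' s
  have hm2 : ∀ k, Measurable fun ω =>
      2 ^ s * (momentBound C (2 * s) * ‖res S (phases ω) z (ket e') k‖ₑ ^ s) :=
    fun k => ((hmω k).const_mul _).const_mul _
  have hm3 : Measurable fun ω => ∑ v ∈ F, ∑ h ∈ outgoing G v, ∑ k ∈ incoming G v,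
      2 ^ s * (momentBound C (2 * s) * ‖res S (phases ω) z (ket e') k‖ₑ ^ s) :=
    Finset.measurable_sum _ fun v _ => Finset.measurable_sum _ fun _ _ =>
      Finset.measurable_sum _ fun k _ => hm2 k
  have hm4 : ∀ f, Measurable fun ω => momentBound C s * ‖res S (phases ω) z (ket e') f‖ₑ ^ s +
      ∑ v ∈ F, ∑ h ∈ outgoing G v, ∑ k ∈ incoming G v,
        2 ^ s * (momentBound C (2 * s) * ‖res S (phases ω) z (ket e') k‖ₑ ^ s) :=
    fun f => ((hmω f).const_mul _).add hm3
  have hcond : ∀ ω, ∫⁻ ζ, ‖res S (phases (F.piecewise ζ ω)) z (ket e') e‖ₑ ^ s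
      ∂Measure.infinitePi (fun _ : V => μ) ≤
      ENNReal.ofReal (2 * r) ^ s * ∑ x ∈ ends e, ∑ f ∈ incoming G x,
        (momentBound C s * ‖res S (phases ω) z (ket e') f‖ₑ ^ s +
        ∑ v ∈ F, ∑ h ∈ outgoing G v, ∑ k ∈ incoming G v,
          2 ^ s * (momentBound C (2 * s) * ‖res S (phases ω) z (ket e') k‖ₑ ^ s)) := by
    intro ω
    have hmp := measurable_phases.comp (measurable_piecewise_left F ω)
    have hm : ∀ f, Measurable fun ζ => ‖(denom z (phases (F.piecewise ζ ω)) e)⁻¹‖ₑ ^ s *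
        ‖res S (phases (F.piecewise ζ ω)) z (ket e') f‖ₑ ^ s := fun f =>
      (((measurable_denom_inv z e).comp hmp).enorm.pow_const s).mul
        (((measurable_res S hz f e').comp hmp).enorm.pow_const s)
    refine (lintegral_mono fun ζ =>
      rpow_enorm_res_le_denom hr hS _ hz hz2 hs0 (by linarith) h1 h2).trans ?_
    rw [lintegral_const_mul _ (Finset.measurable_sum _ fun x _ =>
      Finset.measurable_sum _ fun f _ => hm f)]
    gcongr
    rw [lintegral_finsetSum _ fun x _ => Finset.measurable_sum _ fun f _ => hm f]
    refine Finset.sum_le_sum fun x hx => ?_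
    rw [lintegral_finsetSum _ fun f _ => hm f]
    exact Finset.sum_le_sum fun f hf =>
      lintegral_denom_mul_res_piecewise_le μ hμ hs0 hs1 S hz hx hf ω
  rw [moment, lintegral_infinitePi_eq_piecewise μ F (hmω e)]
  refine (lintegral_mono hcond).trans_eq ?_
  rw [lintegral_const_mul _ (Finset.measurable_sum _ fun x _ =>
      Finset.measurable_sum _ fun f _ => hm4 f),
    lintegral_finsetSum _ fun x _ => Finset.measurable_sum _ fun f _ => hm4 f]
  congr 1
  refine Finset.sum_congr rfl fun x _ => ?_
  rw [lintegral_finsetSum _ fun f _ => hm4 f]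
  refine Finset.sum_congr rfl fun f _ => ?_
  rw [lintegral_add_left ((hmω f).const_mul _), lintegral_const_mul _ (hmω f), moment,
    lintegral_finsetSum _ fun v _ => Finset.measurable_sum _ fun _ _ =>
      Finset.measurable_sum _ fun k _ => hm2 k]
  congr 1
  refine Finset.sum_congr rfl fun v _ => ?_
  rw [lintegral_finsetSum _ fun h _ => Finset.measurable_sum _ fun k _ => hm2 k]
  refine Finset.sum_congr rfl fun h _ => ?_
  rw [lintegral_finsetSum _ fun k _ => hm2 k]
  refine Finset.sum_congr rfl fun k _ => ?_
  rw [lintegral_const_mul _ ((hmω k).const_mul _), lintegral_const_mul _ (hmω k), moment]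

/-- The factor which multiplies `(2 * r) ^ s` in one step of the decay estimate. -/
noncomputable def stepBound (C : ℝ≥0∞) (s : ℝ) (d : ℕ) : ℝ≥0∞ :=
  -- Two ends, `d` incoming edges at each, then at most `2 * (d + 1)` resampled vertices with `d`
  -- outgoing and `d` incoming edges each.
  2 * (d * (momentBound C s +
    (2 * (d + 1) : ℕ) * (d * (d * (2 ^ s * momentBound C (2 * s))))))

theorem stepBound_ne_top (hC : C ≠ ∞) (s : ℝ) (d : ℕ) : stepBound C s d ≠ ∞ := by
  have h1 := momentBound_ne_top (t := s) hC
  have h2 := momentBound_ne_top (t := 2 * s) hC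
  unfold stepBound
  finiteness

theorem sum_le_natCast_mul {ι : Type*} {T : Finset ι} {f : ι → ℝ≥0∞} {n : ℕ} {M : ℝ≥0∞}
    (hn : T.card ≤ n) (h : ∀ i ∈ T, f i ≤ M) : ∑ i ∈ T, f i ≤ n * M := by
  refine (Finset.sum_le_card_nsmul T f M h).trans ?_
  rw [nsmul_eq_mul]
  gcongr

theorem moment_le_of_surroundings (hμ : μ ≤ C • volume) (hs0 : 0 < s) (hs1 : s < 1 / 2)
    {d : ℕ} (hd : ∀ x : V, G.degree x ≤ d)
    {S : ScatteringFamily G} {r : ℝ} (hr : 0 ≤ r)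
    (hS : scatteringDist S (idFamily G) ≤ ENNReal.ofReal r) {z : ℂ} (hz : 1 < ‖z‖)
    (hz2 : ‖z‖ ≤ 2) {e e' : G.Dart} (h1 : e ≠ e') (h2 : e.symm ≠ e') {M : ℝ≥0∞}
    (hM : ∀ f : G.Dart, f.snd ∈ surroundings e → moment μ S z s e' f ≤ M) :
    moment μ S z s e' e ≤ ENNReal.ofReal (2 * r) ^ s * stepBound C s d * M := by
  refine (moment_le_sum μ hμ hs0 hs1 hr hS hz hz2 h1 h2).trans ?_
  rw [mul_assoc]
  gcongr
  have hin : ∀ x, (incoming G x).card ≤ d := fun x => (card_incoming x).trans_le (hd x)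
  have hout : ∀ x, (outgoing G x).card ≤ d := fun x => (card_outgoing x).trans_le (hd x)
  refine (sum_le_natCast_mul (M := d * (momentBound C s * M + (2 * (d + 1) : ℕ) *
    (d * (d * (2 ^ s * (momentBound C (2 * s) * M)))))) (n := 2) Finset.card_le_two
    fun x hx => sum_le_natCast_mul (hin x) fun f hf => add_le_add ?_ ?_).trans_eq ?_
  · gcongr
    exact hM f (by rw [mem_incoming.1 hf]; exact ends_subset_surroundings e hx)
  · refine sum_le_natCast_mul (card_surroundings_le hd e) fun v hv =>
      sum_le_natCast_mul (hout v) fun h _ => sum_le_natCast_mul (hin v) fun k hk => ?_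
    gcongr
    exact hM k (by rwa [mem_incoming.1 hk])
  · rw [stepBound]
    push_cast
    ring

theorem moment_le_pow (hμ : μ ≤ C • volume) (hs0 : 0 < s) (hs1 : s < 1 / 2)
    {d : ℕ} (hd : ∀ x : V, G.degree x ≤ d)
    {S : ScatteringFamily G} {r : ℝ} (hr : 0 ≤ r)
    (hS : scatteringDist S (idFamily G) ≤ ENNReal.ofReal r) {z : ℂ} (hz : 1 < ‖z‖)
    (hz2 : ‖z‖ ≤ 2) (e' : G.Dart) (n : ℕ) :
    ∀ e : G.Dart, ((2 * n : ℕ) : ℕ∞) ≤ G.edist e.snd e'.snd → moment μ S z s e' e ≤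
      (ENNReal.ofReal (2 * r) ^ s * stepBound C s d) ^ n * momentBound C s := by
  induction n with
  | zero =>
    intro e _
    rw [pow_zero, one_mul]
    exact moment_le μ hμ hs0 (by linarith) S hz e' e
  | succ n ih =>
    intro e he
    have h2 : (2 : ℕ∞) ≤ G.edist e.snd e'.snd := by
      refine le_trans ?_ he
      exact_mod_cast (by lia : 2 ≤ 2 * (n + 1))
    rw [pow_succ', mul_assoc]
    -- Distance at least two excludes `e = e'` (distance `0`) and `e.symm = e'` (distance `1`). The
    -- edges `f` of the step end within distance two of `e.snd`, so the induction hypothesis still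
    -- applies to them.
    refine moment_le_of_surroundings μ hμ hs0 hs1 hd hr hS hz hz2 ?_ ?_ fun f hf => ih f ?_
    · rintro rfl
      simp at h2
    · rintro rfl
      have h3 : G.edist e.snd e.symm.snd = 1 := SimpleGraph.edist_eq_one_iff_adj.2 e.adj.symm
      rw [h3] at h2
      exact absurd h2 (by decide)
    · have h3 : G.edist e.snd e'.snd ≤ 2 + G.edist f.snd e'.snd :=
        SimpleGraph.edist_triangle.trans (add_le_add (edist_snd_le_two hf) le_rfl)
      have h4 := he.trans h3
      rw [show 2 * (n + 1) = 2 + 2 * n by ring, Nat.cast_add] at h4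
      exact (ENat.add_le_add_iff_left (by decide)).1 h4

end

/-! ### Exponential decay and the interior of the unit circle -/

section

theorem expDecay_nonneg (g : ℝ) (n : ℕ∞) : 0 ≤ expDecay g n := by
  unfold expDecay
  split_ifs <;> positivity

/-- A geometric bound at even distances is an exponential bound. -/
theorem le_expDecay_of_le_pow {A B : ℝ≥0∞} (hB : B ≠ ∞) {q : ℝ≥0∞} {g : ℝ} (hg : 0 < g)
    (hq : q ≤ ENNReal.ofReal (Real.exp (-2 * g))) {N : ℕ∞}
    (h : ∀ n : ℕ, ((2 * n : ℕ) : ℕ∞) ≤ N → A ≤ q ^ n * B) :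
    A ≤ ENNReal.ofReal (B.toReal * Real.exp g * expDecay g N) := by
  have h' : ∀ n : ℕ, ((2 * n : ℕ) : ℕ∞) ≤ N →
      A ≤ ENNReal.ofReal (Real.exp (-2 * g) ^ n * B.toReal) := fun n hn => by
    rw [ENNReal.ofReal_mul (by positivity), ENNReal.ofReal_toReal hB,
      ENNReal.ofReal_pow (by positivity)]
    exact (h n hn).trans (by gcongr)
  by_cases hN : N = ⊤
  -- Between different components every `n` is admissible, so the bound tends to zero.
  · have h0 : Filter.Tendsto (fun n : ℕ => ENNReal.ofReal (Real.exp (-2 * g) ^ n * B.toReal))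
        Filter.atTop (nhds (ENNReal.ofReal (0 * B.toReal))) :=
      ENNReal.tendsto_ofReal ((tendsto_pow_atTop_nhds_zero_of_lt_one (by positivity)
        (by rw [Real.exp_lt_one_iff]; linarith)).mul_const _)
    have h1 := ge_of_tendsto' h0 fun n => h' n (by rw [hN]; exact le_top)
    rw [zero_mul, ENNReal.ofReal_zero] at h1
    exact h1.trans zero_le
  · obtain ⟨m, rfl⟩ := ENat.ne_top_iff_exists.1 hN
    -- Rounding `m / 2` down loses at most one unit of distance, which the factor `exp g` absorbs.
    refine (h' (m / 2) (by exact_mod_cast Nat.mul_div_le m 2)).trans (ENNReal.ofReal_le_ofReal ?_)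
    rw [expDecay, if_neg hN, ENat.toNat_natCast, mul_comm, mul_assoc, ← Real.exp_nat_mul,
      ← Real.exp_add]
    gcongr
    have h2 : (m : ℝ) ≤ 2 * ((m / 2 : ℕ) : ℝ) + 1 := by
      exact_mod_cast (by lia : m ≤ 2 * (m / 2) + 1)
    nlinarith

variable {V : Type*} {G : SimpleGraph V} [DecidableEq V] [G.LocallyFinite]

/-- Reflection of the spectral parameter at the unit circle. -/
theorem green_eq_conj (S : ScatteringFamily G) (ω : V → Torus) {z : ℂ} (hz0 : z ≠ 0)
    (hz : ‖z‖ ≠ 1) (e e' : G.Dart) :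
    green S ω z e e' = -(z⁻¹ * (z⁻¹ * starRingEnd ℂ (green S ω (starRingEnd ℂ z)⁻¹ e' e) +
      (ket e' : EdgeSpace G) e)) := by
  have hz' : ‖(starRingEnd ℂ z)⁻¹‖ ≠ 1 := by
    rw [norm_inv, RCLike.norm_conj]
    simpa using hz
  set U := walkOp S ω with hU
  have hinner : ∀ ψ χ : EdgeSpace G, inner ℂ (U ψ) (U χ) = inner ℂ ψ χ :=
    fun ψ χ => (walk (dressed S ω)).inner_map_map ψ χ
  have hsolve : ∀ {ζ : ℂ}, ‖ζ‖ ≠ 1 → ∀ ψ : EdgeSpace G,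
      U (Ring.inverse (U - ζ • 1) ψ) = ζ • Ring.inverse (U - ζ • 1) ψ + ψ := by
    intro ζ hζ ψ
    have h := DFunLike.congr_fun (Ring.mul_inverse_cancel _ (isUnit_walkOp_sub S ω hζ)) ψ
    change U (Ring.inverse (U - ζ • 1) ψ) - ζ • Ring.inverse (U - ζ • 1) ψ = ψ at h
    rw [add_comm]
    exact sub_eq_iff_eq_add.1 h
  have hy := hsolve hz (ket e')
  have hw := hsolve hz' (ket e)
  rw [green, green, ← hU]
  set y := Ring.inverse (U - z • 1) (ket e') with hydef
  set w := Ring.inverse (U - (starRingEnd ℂ z)⁻¹ • 1) (ket e) with hwdef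
  have h1 := hinner w y
  rw [hy, hw] at h1
  simp only [inner_add_left, inner_add_right, inner_smul_left, inner_smul_right, map_inv₀,
    Complex.conj_conj] at h1
  rw [inner_ket_left e (ket e')] at h1
  rw [inner_conj_symm]
  field_simp at h1 ⊢
  linear_combination h1

theorem measurable_green (S : ScatteringFamily G) {z : ℂ} (hz0 : z ≠ 0) (hz : ‖z‖ ≠ 1)
    (e e' : G.Dart) : Measurable fun ω => green S ω z e e' := by
  have hout : ∀ {z : ℂ}, 1 < ‖z‖ → ∀ e e' : G.Dart, Measurable fun ω => green S ω z e e' := by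
    intro z hz e e'
    simp only [green_eq]
    exact (measurable_res S hz e e').comp measurable_phases
  rcases lt_or_gt_of_ne hz with h | h
  · have h1 : 1 < ‖(starRingEnd ℂ z)⁻¹‖ := by
      rw [norm_inv, RCLike.norm_conj]
      exact (one_lt_inv₀ (norm_pos_iff.2 hz0)).2 h
    simp only [green_eq_conj S _ hz0 hz]
    have h2 := Complex.continuous_conj.measurable.comp (hout h1 e' e)
    exact (((h2.const_mul z⁻¹).add_const _).const_mul z⁻¹).neg
  · exact hout h e e'

variable (μ : Measure Torus) [IsProbabilityMeasure μ] {C : ℝ≥0∞} {s : ℝ}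

theorem exists_moment_le_expDecay (hC : C ≠ ∞) (hμ : μ ≤ C • volume) (hs0 : 0 < s)
    (hs1 : s < 1 / 2) {d : ℕ} (hd : ∀ x : V, G.degree x ≤ d) {g : ℝ} (hg : 0 < g) :
    ∃ r : ℝ, 0 < r ∧ ∃ c : ℝ, 0 ≤ c ∧ ∀ S : ScatteringFamily G,
      scatteringDist S (idFamily G) ≤ ENNReal.ofReal r → ∀ z : ℂ, 1 < ‖z‖ → ‖z‖ ≤ 2 →
        ∀ e e' : G.Dart, ∫⁻ ω, ‖green S ω z e e'‖ₑ ^ s ∂Measure.infinitePi (fun _ : V => μ) ≤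
          ENNReal.ofReal (c * expDecay g (G.edist e.snd e'.snd)) := by
  set k := (stepBound C s d).toReal with hk
  have hk0 : 0 ≤ k := ENNReal.toReal_nonneg
  set b := Real.exp (-2 * g) / (k + 1) with hb
  have hb0 : 0 < b := by positivity
  -- The radius `r` is chosen so that `(2 * r) ^ s = b`, whence `b * k ≤ exp (-2 * g)`; the `+ 1` in
  -- `b` guards against `k = 0`.
  refine ⟨b ^ s⁻¹ / 2, by positivity, (momentBound C s).toReal * Real.exp g, by positivity,
    fun S hS z hz hz2 e e' => ?_⟩
  have hq : ENNReal.ofReal (2 * (b ^ s⁻¹ / 2)) ^ s * stepBound C s d ≤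
      ENNReal.ofReal (Real.exp (-2 * g)) := by
    rw [mul_div_cancel₀ _ two_ne_zero, ENNReal.ofReal_rpow_of_nonneg (by positivity) hs0.le,
      Real.rpow_inv_rpow hb0.le hs0.ne', ← ENNReal.ofReal_toReal (stepBound_ne_top hC s d),
      ← ENNReal.ofReal_mul hb0.le, ← hk]
    refine ENNReal.ofReal_le_ofReal ?_
    rw [hb, div_mul_eq_mul_div]
    exact div_le_of_le_mul₀ (by positivity) (by positivity) (by gcongr; linarith)
  have h := le_expDecay_of_le_pow (momentBound_ne_top hC) hg hq fun n hn =>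
    moment_le_pow μ hμ hs0 hs1 hd (by positivity) hS hz hz2 e' n e hn
  refine le_of_eq_of_le (lintegral_congr fun ω => ?_) h
  rw [green_eq]
  rfl

theorem exists_lintegral_green_le (hC : C ≠ ∞) (hμ : μ ≤ C • volume) (hs0 : 0 < s)
    (hs1 : s < 1 / 2) {d : ℕ} (hd : ∀ x : V, G.degree x ≤ d) {g : ℝ} (hg : 0 < g) :
    ∃ r : ℝ, 0 < r ∧ ∃ c : ℝ, 0 < c ∧ ∀ S : ScatteringFamily G,
      scatteringDist S (idFamily G) ≤ ENNReal.ofReal r →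
        ∀ z : ℂ, ‖z‖ ∈ Set.Icc (1 / 2 : ℝ) (3 / 2) \ {1} →
          ∀ e e' : G.Dart, ∫⁻ ω, ‖green S ω z e e'‖ₑ ^ s ∂Measure.infinitePi (fun _ : V => μ) ≤
            ENNReal.ofReal (c * expDecay g (G.edist e.snd e'.snd)) := by
  obtain ⟨r, hr, c, hc, hout⟩ := exists_moment_le_expDecay (G := G) μ hC hμ hs0 hs1 hd hg
  -- Inside the circle `‖z⁻¹‖ ^ s ≤ 2` enters twice in front of the reflected element and once in
  -- front of the Kronecker term, giving `4 * c` and `2`.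
  refine ⟨r, hr, 2 + 4 * c, by positivity, fun S hS z hz e e' => ?_⟩
  obtain ⟨⟨hz1, hz2⟩, hz3⟩ := hz
  replace hz3 : ‖z‖ ≠ 1 := hz3
  have hz0 : z ≠ 0 := norm_pos_iff.1 (by linarith)
  have hexp := expDecay_nonneg g (G.edist e.snd e'.snd)
  rcases lt_or_gt_of_ne hz3 with h | h
  · have h1 : ‖(starRingEnd ℂ z)⁻¹‖ = ‖z‖⁻¹ := by rw [norm_inv, RCLike.norm_conj]
    have h2 : ‖z‖⁻¹ ≤ 2 := by
      rw [inv_le_comm₀ (by linarith) two_pos]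
      linarith
    have h3 := hout S hS (starRingEnd ℂ z)⁻¹ (by
      rw [h1]; exact (one_lt_inv₀ (norm_pos_iff.2 hz0)).2 h) (by rw [h1]; exact h2) e' e
    rw [SimpleGraph.edist_comm] at h3
    have hk : ‖(ket e' : EdgeSpace G) e‖ₑ ^ s ≤
        ENNReal.ofReal (expDecay g (G.edist e.snd e'.snd)) := by
      by_cases he : e = e'
      · subst he
        rw [ket_apply_self, expDecay]
        simp
      · rw [ket_apply_ne he, enorm_zero, ENNReal.zero_rpow_of_pos hs0]
        exact zero_le
    have hze : ‖z⁻¹‖ₑ ≤ 2 := by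
      rw [← ofReal_norm, norm_inv]
      exact (ENNReal.ofReal_le_ofReal h2).trans_eq (ENNReal.ofReal_ofNat 2)
    have hzs : ‖z⁻¹‖ₑ ^ s ≤ 2 := by
      refine (ENNReal.rpow_le_rpow hze hs0.le).trans ?_
      exact (ENNReal.rpow_le_rpow_of_exponent_le one_le_two (by linarith : s ≤ 1)).trans_eq
        (ENNReal.rpow_one 2)
    have hpt : ∀ ω, ‖green S ω z e e'‖ₑ ^ s ≤
        4 * ‖green S ω (starRingEnd ℂ z)⁻¹ e' e‖ₑ ^ s +
          2 * ENNReal.ofReal (expDecay g (G.edist e.snd e'.snd)) := by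
      intro ω
      rw [green_eq_conj S ω hz0 hz3, enorm_neg, enorm_mul, ENNReal.mul_rpow_of_nonneg _ _ hs0.le]
      calc _ ≤ 2 * (‖z⁻¹‖ₑ ^ s * ‖green S ω (starRingEnd ℂ z)⁻¹ e' e‖ₑ ^ s
            + ‖(ket e' : EdgeSpace G) e‖ₑ ^ s) := by
            gcongr
            refine (ENNReal.rpow_le_rpow (enorm_add_le _ _) hs0.le).trans
              ((ENNReal.rpow_add_le_add_rpow _ _ hs0.le (by linarith)).trans_eq ?_)
            rw [enorm_mul, ENNReal.mul_rpow_of_nonneg _ _ hs0.le, RCLike.enorm_conj]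
        _ ≤ 2 * (2 * ‖green S ω (starRingEnd ℂ z)⁻¹ e' e‖ₑ ^ s
            + ENNReal.ofReal (expDecay g (G.edist e.snd e'.snd))) := by gcongr
        _ = _ := by ring
    refine (lintegral_mono hpt).trans ?_
    rw [lintegral_add_right _ measurable_const, lintegral_const, measure_univ, mul_one,
      lintegral_const_mul' _ _ (by norm_num)]
    refine (add_le_add (mul_le_mul_right h3 4) le_rfl).trans_eq ?_
    rw [add_mul, ENNReal.ofReal_add (by positivity) (by positivity), mul_assoc,
      ENNReal.ofReal_mul zero_le_two, ENNReal.ofReal_mul zero_le_four, ENNReal.ofReal_ofNat,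
      ENNReal.ofReal_ofNat, add_comm]
  · refine (hout S hS z h (by linarith) e e').trans (ENNReal.ofReal_le_ofReal ?_)
    gcongr
    linarith

end

end ScatteringWalk

/-! ### Transfer from the product measure to the given random phases -/

open ScatteringWalk in
theorem mainTheorem5 {V : Type*} [DecidableEq V] (G : SimpleGraph V) [G.LocallyFinite]
    (hE : G.edgeSet.Countable) (d : ℕ) (hd : ∀ x : V, G.degree x ≤ d)
    (τ : Torus → ℝ) (hτ_nonneg : ∀ᵐ θ, 0 ≤ τ θ) (hτ_bdd : MemLp τ ∞ volume)
    (hτ_prob : IsProbabilityMeasure (lawOfDensity τ))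
    {Ω : Type*} [MeasurableSpace Ω] (P : Measure Ω) [IsProbabilityMeasure P]
    (ω : V → Ω → Torus) (hω_meas : ∀ x, Measurable (ω x))
    (hω_law : ∀ x, P.map (ω x) = lawOfDensity τ) (hω_indep : iIndepFun ω P)
    (s : ℝ) (hs0 : 0 < s) (hs1 : s < 1 / 3) (g : ℝ) (hg : 0 < g) :
    ∃ φ : ℝ, 0 < φ ∧ ∃ c : ℝ, 0 < c ∧
      ∀ S : ScatteringFamily G, scatteringDist S (idFamily G) ≤ ENNReal.ofReal φ →
        ∀ z : ℂ, ‖z‖ ∈ Set.Icc (1 / 2 : ℝ) (3 / 2) \ {1} → ∀ e e' : G.Dart,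
          Integrable (fun a => ‖green S (fun x => ω x a) z e e'‖ ^ s) P ∧
            ∫ a, ‖green S (fun x => ω x a) z e e'‖ ^ s ∂P
              ≤ c * expDecay g (G.edist e.snd e'.snd) := by
  obtain ⟨C, hC, hμ⟩ := lawOfDensity_le hτ_bdd
  obtain ⟨φ, hφ, c, hc, key⟩ := exists_lintegral_green_le (G := G) (lawOfDensity τ) hC hμ hs0
    (by linarith) hd hg
  refine ⟨φ, hφ, c, hc, fun S hS z hz e e' => ?_⟩
  have hz0 : z ≠ 0 := norm_pos_iff.1 (by linarith [hz.1.1])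
  have hm := measurable_green S hz0 hz.2 e e'
  have hmω : Measurable fun a x => ω x a := measurable_pi_lambda _ hω_meas
  have hnn : ∀ a, 0 ≤ ‖green S (fun x => ω x a) z e e'‖ ^ s := fun a => by positivity
  have hmP : Measurable fun a => ‖green S (fun x => ω x a) z e e'‖ ^ s :=
    (hm.comp hmω).norm.pow_const s
  -- Independence with a common law says that the joint law of the phases is the product measure.
  have hmap : P.map (fun a x => ω x a) = Measure.infinitePi fun _ : V => lawOfDensity τ := by
    rw [hω_indep.map_fun_eq_infinitePi_map hω_meas]
    simp only [hω_law]
  have hle : ∫⁻ a, ENNReal.ofReal (‖green S (fun x => ω x a) z e e'‖ ^ s) ∂P ≤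
      ENNReal.ofReal (c * expDecay g (G.edist e.snd e'.snd)) := by
    refine le_of_eq_of_le ?_ (key S hS z hz e e')
    rw [← hmap, lintegral_map (hm.enorm.pow_const s) hmω]
    refine lintegral_congr fun a => ?_
    rw [← ofReal_norm, ENNReal.ofReal_rpow_of_nonneg (norm_nonneg _) hs0.le]
  refine ⟨⟨hmP.aestronglyMeasurable, ?_⟩, ?_⟩
  · rw [hasFiniteIntegral_iff_ofReal (Filter.Eventually.of_forall hnn)]
    exact hle.trans_lt ENNReal.ofReal_lt_top
  · rw [integral_eq_lintegral_of_nonneg_ae (Filter.Eventually.of_forall hnn)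
      hmP.aestronglyMeasurable]
    exact ENNReal.toReal_le_of_le_ofReal (mul_nonneg hc.le (expDecay_nonneg _ _)) hle
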